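/- Let $\mathbb F=\mathbb F_q$ be a finite field with $q$ elements, $A=\mathbb F[T]$, and $K_\infty=\mathbb F((T^{-1}))$ with the absolute value normalized by $|T|=q$. Let $C$ be the completion of an algebraic closure of $K_\infty$, with the unique extension of $|\cdot|$, let $L\subset C$ be a finite extension of $K_\infty$, and let $r\ge 2$. A Drinfeld $A$-module $\phi$ of rank $r$ over $L$ is given by $\phi_T(X)=TX+g_1X^q+\dots+g_rX^{q^r}$ with $g_1,\dots,g_r\in L$ and $g_r\neq 0$; let $a\mapsto\phi_a$ be the induced $\mathbb F$-algebra homomorphism from $A$ to the $\mathbb F$-linear endomorphisms of $C$, and $\operatorname{tor}(\phi)=\bigcup_{0\ne a\in A}\ker(\phi_a)\subset C$. Its period lattice is the free $A$-submodule $\Lambda\subset C$ of rank $r$, with finitely many elements in each ball, such that $e_\Lambda(Tz)=\phi_T(e_\Lambda(z))$ for all $z\in C$, where $e_\Lambda(z)=z\prod_{0\neq\lambda\in\Lambda}(1-z/\lambda)$. For every Drinfeld $A$-module $\phi$ of rank $r$ over $L$ with period lattice $\Lambda$, the field $L(\Lambda)$ is a finite extension of $L$ and $L(\Lambda)=L(\operatorname{tor}(\phi))$.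 Moreover, $L(\Lambda)$ may have arbitrarily large ramification index over $L$: for every $N\in\mathbb N$ there is a Drinfeld $A$-module $\phi$ of rank $r$ over $L$ with period lattice $\Lambda$ such that the ramification index $e(L(\Lambda)|L)=[\,|L(\Lambda)^\times|:|L^\times|\,]$ is at least $N$, and in particular $[L(\Lambda):L]\ge N$. -/

import Mathlib

noncomputable section

namespace DrinfeldPeriods

open Polynomial

open scoped WithZero NNReal

section Fields

variable (F : Type*) [Field F]

/-- The field `K_∞ = F((T⁻¹))`: Laurent series over `F` whose variable is read as `T⁻¹`. This is a
`def`, so the Mathlib instance that lets a polynomial in `X` act on `F⸨X⸩` by `X` itself is not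
available on it. -/
def KInf : Type _ := LaurentSeries F

instance : Field (KInf F) := inferInstanceAs (Field (LaurentSeries F))

instance : Algebra F (KInf F) := inferInstanceAs (Algebra F (LaurentSeries F))

/-- The element `T` of `K_∞ = F((T⁻¹))`. -/
def KInf.T : KInf F := (HahnSeries.single (-1 : ℤ) (1 : F) : LaurentSeries F)

/-- `A = F[T]` acts on `K_∞` through the inclusion of `A` in `K_∞`. -/
instance : Algebra F[X] (KInf F) := (aeval (KInf.T F)).toAlgebra

theorem KInf.algebraMap_apply (a : F[X]) : algebraMap F[X] (KInf F) a = aeval (KInf.T F) a := rfl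

instance : IsScalarTower F F[X] (KInf F) :=
  IsScalarTower.of_algebraMap_eq fun x => by
    rw [KInf.algebraMap_apply, AlgHom.commutes]

/-- The valuation of `K_∞` at the place `∞`, written multiplicatively. -/
instance : Valued (KInf F) ℤᵐ⁰ := inferInstanceAs (Valued (LaurentSeries F) ℤᵐ⁰)

theorem KInf.valuation_surjective :
    Function.Surjective (Valued.v : Valuation (KInf F) ℤᵐ⁰) :=
  LaurentSeries.valuation_surjective F

theorem KInf.valuation_T : (Valued.v : Valuation (KInf F) ℤᵐ⁰) (KInf.T F) = WithZero.exp 1 :=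
  LaurentSeries.valuation_single_zpow F (-1)

instance : (Valued.v : Valuation (KInf F) ℤᵐ⁰).IsNontrivial where
  exists_val_nontrivial := ⟨KInf.T F, by rw [KInf.valuation_T]; decide⟩

instance : (Valued.v : Valuation (KInf F) ℤᵐ⁰).IsRankOneDiscrete :=
  Valuation.IsRankOneDiscrete.mk' _

variable [Fintype F]

theorem one_lt_card_nnreal : (1 : ℝ≥0) < Fintype.card F := by
  exact_mod_cast Fintype.one_lt_card

/-- The base `q` of the absolute value, so that `|T| = q`. -/
instance : (Valued.v : Valuation (KInf F) ℤᵐ⁰).RankOne :=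
  Valuation.IsRankOneDiscrete.rankOne _ (one_lt_card_nnreal F)

/-- `K_∞` with its absolute value, normalized by `|T| = q`. -/
instance : NontriviallyNormedField (KInf F) :=
  Valued.toNontriviallyNormedField (KInf F) ℤᵐ⁰

theorem KInf.norm_def (x : KInf F) :
    ‖x‖ = WithZeroMulInt.toNNReal (one_lt_card_nnreal F).ne_bot (Valued.v x) := by
  change ((WithZeroMulInt.toNNReal (one_lt_card_nnreal F).ne_bot
    (Valuation.IsRankOneDiscrete.valueGroup₀_equiv_withZeroMulInt Valued.v
      (Valued.v.restrict x)) : ℝ≥0) : ℝ) = _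
  rw [Valuation.IsRankOneDiscrete.valueGroup₀_equiv_withZeroMulInt_restrict_apply_of_surjective
      (KInf.valuation_surjective F)]

theorem KInf.norm_T : ‖KInf.T F‖ = Fintype.card F := by
  rw [KInf.norm_def, KInf.valuation_T, WithZeroMulInt.toNNReal_neg_apply _ (by simp)]
  simp [WithZero.exp]

instance : CompleteSpace (KInf F) := inferInstanceAs (CompleteSpace (LaurentSeries F))

instance : IsUltrametricDist (KInf F) := inferInstance

/-- A fixed algebraic closure of `K_∞`. -/
abbrev KInfAlgCl : Type _ := AlgebraicClosure (KInf F)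

/-- The absolute value of the algebraic closure of `K_∞` is the unique extension of that of `K_∞`,
which is the spectral norm. -/
instance : NontriviallyNormedField (KInfAlgCl F) :=
  spectralNorm.nontriviallyNormedField (KInf F) (KInfAlgCl F)

instance : NormedAlgebra (KInf F) (KInfAlgCl F) := spectralNorm.normedAlgebra _ _

instance : IsUltrametricDist (KInfAlgCl F) :=
  IsUltrametricDist.isUltrametricDist_of_forall_norm_add_le_max_norm
    (isNonarchimedean_spectralNorm (K := KInf F) (L := KInfAlgCl F))

/-- The field `C`, the completed algebraic closure of `K_∞`. -/
abbrev CInf : Type _ := UniformSpace.Completion (KInfAlgCl F)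

instance : UniformContinuousConstSMul (KInf F) (KInfAlgCl F) :=
  uniformContinuousConstSMul_of_continuousConstSMul _ _

instance {R : Type*} [CommSemiring R] [Algebra R (KInf F)] :
    UniformContinuousConstSMul R (KInfAlgCl F) where
  uniformContinuous_const_smul a := by
    simp_rw [← algebraMap_smul (KInf F) a]
    exact uniformContinuous_const_smul (algebraMap R (KInf F) a)
instance : IsScalarTower (KInf F) (KInfAlgCl F) (CInf F) :=
  IsScalarTower.of_algebraMap_eq (congrFun rfl)

instance : IsScalarTower F (KInf F) (CInf F) := IsScalarTower.of_algebraMap_eq (congrFun rfl)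

instance : IsScalarTower F[X] (KInf F) (CInf F) := IsScalarTower.of_algebraMap_eq (congrFun rfl)

instance : IsScalarTower F F[X] (CInf F) := IsScalarTower.of_algebraMap_eq fun x => by
  rw [IsScalarTower.algebraMap_apply F (KInf F) (CInf F),
    IsScalarTower.algebraMap_apply F F[X] (KInf F),
    ← IsScalarTower.algebraMap_apply F[X] (KInf F) (CInf F)]

instance : IsUltrametricDist (CInf F) := IsUltrametricDist.of_normedAlgebra (KInf F)

instance : NontriviallyNormedField (CInf F) where
  non_trivial := by
    obtain ⟨x, hx⟩ := NontriviallyNormedField.non_trivial (α := KInf F)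
    exact ⟨algebraMap (KInf F) (CInf F) x, by rwa [norm_algebraMap']⟩

/-- The element `T` of `C`. -/
def CInf.T : CInf F := algebraMap (KInf F) (CInf F) (KInf.T F)

theorem CInf.X_smul (z : CInf F) : (X : F[X]) • z = CInf.T F * z := by
  rw [← algebraMap_smul (KInf F) (X : F[X]) z, KInf.algebraMap_apply, aeval_X, Algebra.smul_def,
    CInf.T]

theorem CInf.norm_T : ‖CInf.T F‖ = Fintype.card F := by
  rw [CInf.T, norm_algebraMap', KInf.norm_T]

end Fields

section DrinfeldModules

variable {F : Type*} [Field F] [Fintype F]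

/-- A Drinfeld `F[T]`-module of rank `r` over a field `L` between `K_∞` and `C`, given by the
coefficients `g_0 = T, g_1, …, g_r ∈ L` with `g_r ≠ 0` of its operator polynomial
`φ_T(X) = T X + g_1 X^q + ⋯ + g_r X^(q^r)`, where `q` is the cardinality of `F`. -/
structure DrinfeldModule (L : IntermediateField (KInf F) (CInf F)) (r : ℕ) where
  /-- The coefficients `g_0, …, g_r`. -/
  coeff : Fin (r + 1) → L
  coeff_zero : coeff 0 = algebraMap (KInf F) L (KInf.T F)
  coeff_last : coeff (Fin.last r) ≠ 0

namespace DrinfeldModule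

variable {L : IntermediateField (KInf F) (CInf F)} {r : ℕ} (φ : DrinfeldModule L r)

/-- The `F`-linear operator `z ↦ φ_T(z)` on `C`. -/
def opT : Module.End F (CInf F) where
  toFun z := ∑ i : Fin (r + 1), (φ.coeff i : CInf F) * z ^ Fintype.card F ^ (i : ℕ)
  map_add' x y := by
    have h (n : ℕ) (z : CInf F) :
        z ^ Fintype.card F ^ n = (FiniteField.frobeniusAlgHom F (CInf F) ^ n) z := by
      simp [AlgHom.coe_pow, FiniteField.coe_frobeniusAlgHom, pow_iterate]
    simp only [h, map_add, mul_add, Finset.sum_add_distrib]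
  map_smul' c x := by
    simp [_root_.smul_pow, FiniteField.pow_card_pow, Finset.smul_sum]

/-- The action `a ↦ φ_a` of `F[T]` on `C`: the `F`-algebra homomorphism that sends `T` to `φ_T`. -/
def op : F[X] →ₐ[F] Module.End F (CInf F) := aeval φ.opT

/-- The set `φ[a]` of `a`-division points. -/
def divisionPoints (a : F[X]) : Set (CInf F) := {z | φ.op a z = 0}

/-- The torsion `tor(φ)`, the union of all `φ[a]` with `a ≠ 0`. -/
def tor : Set (CInf F) := ⋃ (a : F[X]) (_ : a ≠ 0), φ.divisionPoints a

end DrinfeldModule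

/-- An `F[T]`-lattice of rank `r` in `C`: a free `F[T]`-submodule of rank `r` that is discrete, in
the sense that it has only finitely many elements in each ball. -/
structure IsLattice (r : ℕ) (Λ : Submodule F[X] (CInf F)) : Prop where
  free : Module.Free F[X] Λ
  finite : Module.Finite F[X] Λ
  finrank_eq : Module.finrank F[X] Λ = r
  discrete : ∀ R : ℝ, {l : CInf F | l ∈ Λ ∧ ‖l‖ ≤ R}.Finite

/-- The exponential function `e_Λ(z) = z ∏ (1 - z / λ)`, the product being over the nonzero
elements `λ` of `Λ`. It converges for every lattice. -/
def latticeExp (Λ : Submodule F[X] (CInf F)) (z : CInf F) : CInf F :=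
  z * ∏' l : {l : CInf F // l ∈ Λ ∧ l ≠ 0}, (1 - z / (l : CInf F))

/-- `Λ` is the period lattice of the Drinfeld module `φ` of rank `r`: it is a lattice of rank `r`
and `e_Λ(T z) = φ_T(e_Λ(z))` for all `z ∈ C`. -/
structure IsPeriodLattice {L : IntermediateField (KInf F) (CInf F)} {r : ℕ}
    (φ : DrinfeldModule L r) (Λ : Submodule F[X] (CInf F)) : Prop where
  isLattice : IsLattice r Λ
  latticeExp_T_mul : ∀ z : CInf F, latticeExp Λ (CInf.T F * z) = φ.opT (latticeExp Λ z)

/-- The value group `|M^×|` of a subfield `M` of `C`. -/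
def valueGroup (M : Subfield (CInf F)) : Subgroup ℝˣ :=
  (Units.map (((normHom : CInf F →*₀ ℝ) : CInf F →* ℝ).comp (M.subtype : M →* CInf F))).range

/-- The ramification index `e(M | E)` of subfields `E ⊆ M` of `C`, which is the index of the value
group of `E` in that of `M` (with the value `0` if that index is infinite). -/
def ramificationIndex (E M : Subfield (CInf F)) : ℕ :=
  (valueGroup E).relIndex (valueGroup M)

end DrinfeldModules

end DrinfeldPeriods

end

open DrinfeldPeriods

/-! Write `e` for the lattice exponential `latticeExp Λ`. It is `F`-linear with zero set exactly
`Λ`, satisfies `φ_a(e(z)) = e(a z)`, and agrees with `z` to first order near 0.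

For `l ∈ Λ` the torsion points `y_n = e(l / T^n)` satisfy `φ_T(y_(n+1)) = y_n`, tend to 0, and `T^n
y_n → l`. Near 0 the operator `φ_T` is a small perturbation of multiplication by `T`, so a small
preimage of `y` under `φ_T` is a limit of elements of any closed field over `L` containing `y`
(`mem_of_opT_mem`). Hence all late `y_n`, and with them `l`, lie in the finite extension generated
by a single `y_n`. As `Λ` is finitely generated, `L(Λ)` is finite over `L`, and contained in `L(tor
φ)`. Conversely, by counting, every torsion point is some `e(l / a)`; this is a limit of elements of
`L(Λ)`, which is closed because it is finite over `K_∞`.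

For ramification, let `ω` be a root of `∏ (X - b) = T^m`, with `b` over the polynomials of degree `<
n`. The left side is additive in `X`, so the conjugates of `ω` are among the translates `ω + b`, and
the span of `1, ω, …, ω^(r-1)` is Galois stable. With `m = n q^n + 1`, `|ω|^(q^n) = q^m` and `m` is
prime to `q`, so the powers `ω^i` with `i < q^n` have norms distinct modulo `q^ℤ`. Thus the span is
a lattice, and `ω` forces large ramification. A Galois stable lattice descends to a Drinfeld module
over `L`, because Galois permutes the values of `e` on `T⁻¹Λ`, which determine the coefficients
(`exists_drinfeldModule_of_galois`). -/

noncomputable section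

namespace DrinfeldPeriods

open Polynomial Filter Topology

/-! ### `F`-linear polynomials attached to finite `F`-spaces. -/

section LinearizedPolynomials

variable {F : Type*} [Field F] [Fintype F]

theorem sub_pow_card_pow {R : Type*} [CommRing R] [Algebra F R] (x y : R) (n : ℕ) :
    (x - y) ^ Fintype.card F ^ n = x ^ Fintype.card F ^ n - y ^ Fintype.card F ^ n := by
  have h (z : R) : z ^ Fintype.card F ^ n = (FiniteField.frobeniusAlgHom F R ^ n) z := by
    simp [AlgHom.coe_pow, FiniteField.coe_frobeniusAlgHom, pow_iterate]
  simp only [h, map_sub]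

theorem add_pow_card_pow {R : Type*} [CommRing R] [Algebra F R] (x y : R) (n : ℕ) :
    (x + y) ^ Fintype.card F ^ n = x ^ Fintype.card F ^ n + y ^ Fintype.card F ^ n := by
  have h (z : R) : z ^ Fintype.card F ^ n = (FiniteField.frobeniusAlgHom F R ^ n) z := by
    simp [AlgHom.coe_pow, FiniteField.coe_frobeniusAlgHom, pow_iterate]
  simp only [h, map_add]

theorem sum_pow_card {R ι : Type*} [CommRing R] [Algebra F R] (s : Finset ι) (f : ι → R) :
    (∑ i ∈ s, f i) ^ Fintype.card F = ∑ i ∈ s, f i ^ Fintype.card F := by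
  simp only [← FiniteField.frobeniusAlgHom_apply F R, map_sum]

theorem prod_X_sub_C_eq_X_pow_card_sub_X :
    ∏ c : F, (X - C c) = (X ^ Fintype.card F - X : F[X]) := by
  have hm : (X ^ Fintype.card F - X : F[X]).Monic :=
    monic_X_pow_sub (by rw [degree_X]; exact_mod_cast Fintype.one_lt_card)
  have h := prod_multiset_X_sub_C_of_monic_of_roots_card_eq hm (by
    rw [FiniteField.roots_X_pow_card_sub_X,
      FiniteField.X_pow_card_sub_X_natDegree_eq F Fintype.one_lt_card]
    rfl)
  rwa [FiniteField.roots_X_pow_card_sub_X] at h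

variable {E : Type*} [Field E] [Algebra F E]

/-- The homogenized form of `∏ (X - c) = X^q - X`, obtained by substituting `Y / z` for `X`. -/
theorem prod_sub_C_smul (Y : E[X]) (z : E) :
    ∏ c : F, (Y - C (c • z)) = Y ^ Fintype.card F - C (z ^ (Fintype.card F - 1)) * Y := by
  have hq : 1 < Fintype.card F := Fintype.one_lt_card
  rcases eq_or_ne z 0 with rfl | hz
  · simp [Nat.sub_ne_zero_of_lt hq, Finset.card_univ]
  have h1 : ∏ c : F, (C z⁻¹ * Y - C (algebraMap F E c)) =
      (C z⁻¹ * Y) ^ Fintype.card F - C z⁻¹ * Y := by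
    have := congrArg (aeval (C z⁻¹ * Y)) (prod_X_sub_C_eq_X_pow_card_sub_X (F := F))
    simpa [map_prod, Polynomial.algebraMap_apply] using this
  have h2 (c : F) : Y - C (c • z) = C z * (C z⁻¹ * Y - C (algebraMap F E c)) := by
    rw [mul_sub, ← mul_assoc, ← C_mul, mul_inv_cancel₀ hz, C_1, one_mul, Algebra.smul_def,
      mul_comm (algebraMap F E c), C_mul]
  simp_rw [h2]
  rw [Finset.prod_mul_distrib, h1, Finset.prod_const, Finset.card_univ, mul_sub, mul_pow,
    ← mul_assoc, ← mul_assoc, ← mul_pow, ← C_mul, mul_inv_cancel₀ hz, C_1, one_pow, one_mul,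
    ← C_pow, ← C_mul]
  congr 3
  rw [← Nat.sub_add_cancel hq.le, pow_succ, mul_assoc, mul_inv_cancel₀ hz]
  simp

/-- The product `∏ (X - v)` over the `F`-span of `v 0, …, v (k - 1)` (counted with multiplicity) is
an `F`-linear polynomial. -/
theorem exists_prod_X_sub_C_sum_smul_eq (k : ℕ) (v : Fin k → E) :
    ∃ c : ℕ → E, c k = 1 ∧ ∏ a : Fin k → F, (X - C (∑ i, a i • v i)) =
      ∑ i ∈ Finset.range (k + 1), C (c i) * X ^ Fintype.card F ^ i := by
  induction k with
  | zero => exact ⟨fun _ => 1, rfl, by simp⟩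
  | succ k ih =>
    obtain ⟨c, hc, h⟩ := ih (fun i => v i.succ)
    set P : E[X] := ∏ a : Fin k → F, (X - C (∑ i, a i • v i.succ)) with hP
    -- `P` is additive and `F`-homogeneous, so translating its argument by `u • v 0` subtracts the
    -- constant `u • P(v 0)`. Multiplying over `u` gives `P^q - P(v 0)^(q-1) P`.
    have hcomp (u : F) : P.comp (X - C (u • v 0)) = P - C (u • P.eval (v 0)) := by
      rw [h]
      simp only [Polynomial.sum_comp, mul_comp, C_comp, pow_comp, X_comp, sub_pow_card_pow,
        mul_sub, Finset.sum_sub_distrib]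
      congr 1
      simp only [eval_finsetSum, eval_mul, eval_C, eval_pow, eval_X, Finset.smul_sum,
        _root_.smul_pow, FiniteField.pow_card_pow, map_sum, ← C_pow, ← C_mul, mul_smul_comm]
    have hprod : ∏ a : Fin (k + 1) → F, (X - C (∑ i, a i • v i)) =
        P ^ Fintype.card F - C (P.eval (v 0) ^ (Fintype.card F - 1)) * P := by
      rw [← prod_sub_C_smul, ← (Fin.consEquiv fun _ => F).prod_comp, Fintype.prod_prod_type]
      refine Finset.prod_congr rfl fun u _ => ?_
      rw [← hcomp, hP, prod_comp]
      refine Finset.prod_congr rfl fun a _ => ?_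
      simp [Fin.consEquiv, Fin.sum_univ_succ, sub_sub]
    set z := P.eval (v 0) ^ (Fintype.card F - 1)
    -- `P^q` shifts the exponents `q^i` up by one, hence has no term `i = 0`; the multiple of `P`
    -- has no term `i = k + 1`.
    refine ⟨fun i => (if i = 0 then 0 else c (i - 1) ^ Fintype.card F) -
      (if i = k + 1 then 0 else z * c i), by simp [hc], ?_⟩
    rw [hprod, h, sum_pow_card]
    simp only [C_sub, sub_mul, Finset.sum_sub_distrib]
    congr 1
    · rw [Finset.sum_range_succ' _ (k + 1)]
      simp only [mul_pow, ← C_pow, ← pow_mul, ← pow_succ]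
      simp
    · rw [Finset.sum_range_succ _ (k + 1), Finset.mul_sum]
      simp only [if_true, C_0, zero_mul, add_zero]
      refine Finset.sum_congr rfl fun i hi => ?_
      rw [if_neg (by have := Finset.mem_range.1 hi; omega), C_mul, mul_assoc]

/-- For a finite `F`-subspace `V`, the function `z ↦ ∏ (z - v)`, with `v ∈ V`, is `F`-linear. -/
theorem exists_linearMap_eq_prod_sub (V : Submodule F E) (s : Finset E) (hs : (s : Set E) = V) :
    ∃ f : E →ₗ[F] E, ∀ z, f z = ∏ v ∈ s, (z - v) := by
  classical
  have hfin : Finite V := by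
    have : (V : Set E).Finite := hs ▸ s.finite_toSet
    exact this
  have : Module.Finite F V := Module.Finite.of_finite
  let b := Module.finBasis F V
  obtain ⟨c, -, hc⟩ := exists_prod_X_sub_C_sum_smul_eq (F := F) (Module.finrank F V)
    (fun i => (b i : E))
  have key (z : E) : ∏ v ∈ s, (z - v) =
      ∑ i ∈ Finset.range (Module.finrank F V + 1), c i * z ^ Fintype.card F ^ i := by
    have := congrArg (eval z) hc
    simp only [eval_prod, eval_sub, eval_X, eval_C, eval_finsetSum, eval_mul, eval_pow] at this
    rw [← this]
    symm
    refine Finset.prod_bij (fun a _ => ((b.equivFun.symm a : V) : E)) ?_ ?_ ?_ ?_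
    · intro a _
      rw [← Finset.mem_coe, hs]
      exact Subtype.coe_prop _
    · intro a _ a' _ h
      exact b.equivFun.symm.injective (Subtype.ext h)
    · intro v hv
      rw [← Finset.mem_coe, hs] at hv
      exact ⟨b.equivFun ⟨v, hv⟩, Finset.mem_univ _, by simp⟩
    · intro a _
      simp [Module.Basis.equivFun_symm_apply]
  refine ⟨{ toFun := fun z => ∏ v ∈ s, (z - v), map_add' := fun x y => ?_,
            map_smul' := fun a x => ?_ }, fun z => rfl⟩
  · simp only [key, add_pow_card_pow, mul_add, Finset.sum_add_distrib]
  · simp [key, _root_.smul_pow, FiniteField.pow_card_pow, Finset.smul_sum]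

end LinearizedPolynomials

/-! ### Products in ultrametric fields. -/

section Ultrametric

variable {E : Type*} [NormedField E] [IsUltrametricDist E]

theorem norm_prod_one_add_sub_one_le {ι : Type*} (s : Finset ι) (f : ι → E) {δ : ℝ} (hδ : 0 ≤ δ)
    (hδ1 : δ ≤ 1) (hf : ∀ i ∈ s, ‖f i‖ ≤ δ) : ‖∏ i ∈ s, (1 + f i) - 1‖ ≤ δ := by
  classical
  induction s using Finset.induction_on with
  | empty => simpa
  | insert a s ha ih =>
    have h1 := ih fun i hi => hf i (Finset.mem_insert_of_mem hi)
    have h2 := hf a (Finset.mem_insert_self a s)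
    rw [Finset.prod_insert ha, show (1 + f a) * ∏ i ∈ s, (1 + f i) - 1 =
      (∏ i ∈ s, (1 + f i) - 1) + f a * (1 + (∏ i ∈ s, (1 + f i) - 1)) by ring]
    refine (IsUltrametricDist.norm_add_le_max _ _).trans (max_le h1 ?_)
    rw [norm_mul]
    refine (mul_le_mul h2 ?_ (norm_nonneg _) hδ).trans_eq (mul_one δ)
    exact (IsUltrametricDist.norm_add_le_max _ _).trans (max_le norm_one.le (h1.trans hδ1))

/-- Expand the product into a sum over finite index sets `s`. The terms `∏ f i` are bounded by a
constant `B`, since only finitely many `f i` have norm at least 1. If `s` contains an index with `‖f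
i‖ < ε / B`, its term is below `ε`; all other `s` are subsets of one finite set. -/
theorem multipliable_one_add_of_tendsto_cofinite [CompleteSpace E] {ι : Type*} {f : ι → E}
    (hf : Tendsto f cofinite (𝓝 0)) : Multipliable fun i => 1 + f i := by
  classical
  refine multipliable_one_add_of_summable_prod
    (NonarchimedeanAddGroup.summable_of_tendsto_cofinite_zero ?_)
  have hfin (ε : ℝ) (hε : 0 < ε) : {i | ε ≤ ‖f i‖}.Finite := by
    have := Metric.tendsto_nhds.1 hf ε hε
    rw [eventually_cofinite] at this
    simpa using this
  set S := (hfin 1 one_pos).toFinset with hS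
  have hbound (s : Finset ι) : ‖∏ i ∈ s, f i‖ ≤ ∏ i ∈ S, max 1 ‖f i‖ := by
    rw [norm_prod]
    calc ∏ i ∈ s, ‖f i‖ ≤ ∏ i ∈ s, max 1 ‖f i‖ :=
          Finset.prod_le_prod (fun _ _ => norm_nonneg _) fun _ _ => le_max_right _ _
      _ ≤ ∏ i ∈ s ∪ S, max 1 ‖f i‖ :=
          Finset.prod_mono_set_of_one_le (fun _ => le_max_left _ _) Finset.subset_union_left
      _ = ∏ i ∈ S, max 1 ‖f i‖ := by
          symm
          refine Finset.prod_subset Finset.subset_union_right fun i _ hi => max_eq_left ?_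
          simp only [hS, Set.Finite.mem_toFinset, Set.mem_ofPred_eq, not_le] at hi
          exact hi.le
  set B := ∏ i ∈ S, max 1 ‖f i‖
  have hB : 0 < B := Finset.prod_pos fun _ _ => lt_max_of_lt_left one_pos
  rw [Metric.tendsto_nhds]
  intro ε hε
  rw [eventually_cofinite]
  refine (hfin (ε / B) (div_pos hε hB)).toFinset.powerset.finite_toSet.subset fun s hs => ?_
  simp only [Finset.coe_powerset, Set.mem_preimage, Set.mem_powerset_iff]
  intro i hi
  simp only [Set.Finite.coe_toFinset, Set.mem_ofPred_eq]
  by_contra! hlt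
  refine hs ?_
  rw [dist_zero_right, ← Finset.mul_prod_erase s f hi, norm_mul]
  calc ‖f i‖ * ‖∏ j ∈ s.erase i, f j‖ ≤ ‖f i‖ * B :=
        mul_le_mul_of_nonneg_left (hbound _) (norm_nonneg _)
    _ < ε / B * B := mul_lt_mul_of_pos_right hlt hB
    _ = ε := div_mul_cancel₀ _ hB.ne'

end Ultrametric

/-! ### Exponentials of finite `F`-spaces. -/

section FiniteExponential

variable {F : Type*} [Field F] [Fintype F] {E : Type*} [Field E] [Algebra F E] [DecidableEq E]

/-- The exponential function `z ∏ (1 - z / v)` of a finite set. -/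
def finsetExp (s : Finset E) (z : E) : E := z * ∏ v ∈ s.erase 0, (1 - z / v)

theorem finsetExp_eq {s : Finset E} (hs : 0 ∈ s) (z : E) :
    finsetExp s z = (∏ v ∈ s.erase 0, (-v))⁻¹ * ∏ v ∈ s, (z - v) := by
  rw [finsetExp, ← Finset.mul_prod_erase s _ hs, sub_zero, mul_left_comm, ← Finset.prod_inv_distrib,
    ← Finset.prod_mul_distrib]
  congr 1
  refine Finset.prod_congr rfl fun v hv => ?_
  have := Finset.ne_of_mem_erase hv
  field_simp
  ring

theorem exists_linearMap_eq_finsetExp (V : Submodule F E) (s : Finset E) (hs : (s : Set E) = V) :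
    ∃ f : E →ₗ[F] E, ∀ z, f z = finsetExp s z := by
  obtain ⟨f, hf⟩ := exists_linearMap_eq_prod_sub V s hs
  have h0 : 0 ∈ s := by rw [← Finset.mem_coe, hs]; exact V.zero_mem
  exact ⟨(LinearMap.mulLeft F (∏ v ∈ s.erase 0, (-v))⁻¹).comp f, fun z => by
    simp [hf, finsetExp_eq h0]⟩

theorem finsetExp_sub (V : Submodule F E) (s : Finset E) (hs : (s : Set E) = V) (x y : E) :
    finsetExp s (x - y) = finsetExp s x - finsetExp s y := by
  obtain ⟨f, hf⟩ := exists_linearMap_eq_finsetExp V s hs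
  simp only [← hf, map_sub]

theorem finsetExp_eq_zero_iff {s : Finset E} (hs : 0 ∈ s) (z : E) :
    finsetExp s z = 0 ↔ z ∈ s := by
  rw [finsetExp_eq hs, mul_eq_zero, or_iff_right, Finset.prod_eq_zero_iff]
  · simp [sub_eq_zero]
  · rw [inv_eq_zero, Finset.prod_eq_zero_iff]
    simp

/-- By additivity the right side is `e(x - z) / e(x)` for `e = finsetExp s`. Expanding both products
and reindexing by `v ↦ -v` gives the left side. -/
theorem prod_one_sub_div_add (V : Submodule F E) (s : Finset E) (hs : (s : Set E) = V) (z x : E)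
    (hx : x ∉ s) :
    ∏ v ∈ s, (1 - z / (v + x)) = 1 - finsetExp s z / finsetExp s x := by
  have h0 : 0 ∈ s := by rw [← Finset.mem_coe, hs]; exact V.zero_mem
  have hneg {v : E} (hv : v ∈ s) : -v ∈ s := by
    rw [← Finset.mem_coe, hs] at hv ⊢
    exact V.neg_mem hv
  have hne : finsetExp s x ≠ 0 := by rwa [Ne, finsetExp_eq_zero_iff h0]
  have hk : (∏ v ∈ s.erase 0, (-v))⁻¹ ≠ 0 := by
    rw [Ne, inv_eq_zero, ← Ne, Finset.prod_ne_zero_iff]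
    simp +contextual
  rw [one_sub_div hne, ← finsetExp_sub V s hs, finsetExp_eq h0, finsetExp_eq h0,
    mul_div_mul_left _ _ hk, ← Finset.prod_div_distrib]
  refine Finset.prod_bij' (fun v _ => -v) (fun v _ => -v) (fun _ => hneg) (fun _ => hneg)
    (by simp) (by simp) fun v hv => ?_
  have : v + x ≠ 0 := fun h => hx (by
    rw [eq_neg_of_add_eq_zero_right h]
    exact hneg hv)
  rw [sub_neg_eq_add, sub_neg_eq_add, one_sub_div this, add_comm x v]
  congr 1
  ring

end FiniteExponential

/-! ### The exponential of a discrete module: convergence, linearity, zeros. -/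

section LatticeExp

variable {F : Type*} [Field F] [Fintype F]

theorem norm_algebraMap_constant {c : F} (hc : c ≠ 0) : ‖algebraMap F (CInf F) c‖ = 1 := by
  have h : algebraMap F (CInf F) c ^ (Fintype.card F - 1) = 1 := by
    rw [← map_pow, FiniteField.pow_card_sub_one_eq_one c hc, map_one]
  have hq : 1 < Fintype.card F := Fintype.one_lt_card
  have h' := congrArg norm h
  rw [norm_pow, norm_one] at h'
  exact (pow_eq_one_iff_of_nonneg (norm_nonneg _) (by omega)).1 h'

theorem norm_constant_smul_le (c : F) (z : CInf F) : ‖c • z‖ ≤ ‖z‖ := by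
  rcases eq_or_ne c 0 with rfl | hc
  · simp
  · rw [Algebra.smul_def, norm_mul, norm_algebraMap_constant hc, one_mul]

variable {Λ : Submodule F[X] (CInf F)}

/-- The elements of norm at most `R` of an `F[T]`-submodule of `C`. -/
def ballSubmodule (Λ : Submodule F[X] (CInf F)) {R : ℝ} (hR : 0 ≤ R) : Submodule F (CInf F) where
  carrier := {l | l ∈ Λ ∧ ‖l‖ ≤ R}
  add_mem' ha hb := ⟨Λ.add_mem ha.1 hb.1,
    (IsUltrametricDist.norm_add_le_max _ _).trans (max_le ha.2 hb.2)⟩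
  zero_mem' := ⟨Λ.zero_mem, by simpa⟩
  smul_mem' c x hx := ⟨(Λ.restrictScalars F).smul_mem c hx.1,
    (norm_constant_smul_le c x).trans hx.2⟩

variable (hΛ : ∀ R : ℝ, {l : CInf F | l ∈ Λ ∧ ‖l‖ ≤ R}.Finite)

include hΛ

theorem multipliable_latticeExp (z : CInf F) :
    Multipliable fun l : {l : CInf F // l ∈ Λ ∧ l ≠ 0} => 1 - z / (l : CInf F) := by
  simp_rw [sub_eq_add_neg]
  refine multipliable_one_add_of_tendsto_cofinite ?_
  rw [Metric.tendsto_nhds]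
  intro ε hε
  rw [eventually_cofinite]
  refine ((hΛ (‖z‖ / ε)).preimage Subtype.val_injective.injOn).subset fun l hl => ⟨l.2.1, ?_⟩
  simp only [dist_zero_right, norm_neg, norm_div, not_lt, Set.mem_ofPred_eq] at hl
  have : 0 < ‖(l : CInf F)‖ := norm_pos_iff.2 l.2.2
  rw [le_div_iff₀ this] at hl
  rwa [le_div_iff₀ hε, mul_comm]

-- Balls exhaust `Λ`, so the partial products over balls converge along the cofinal family. This
-- reduces identities for `latticeExp` to finite `F`-spaces.
open Classical in
theorem tendsto_finsetExp (z : CInf F) :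
    Tendsto (fun R : ℝ => finsetExp (hΛ R).toFinset z) atTop (𝓝 (latticeExp Λ z)) := by
  refine Tendsto.const_mul z ?_
  have h := (multipliable_latticeExp hΛ z).hasProd
  have hmono : Monotone fun R : ℝ =>
      ((hΛ R).toFinset.erase 0).subtype fun l => l ∈ Λ ∧ l ≠ 0 := by
    intro R R' hR l hl
    simp only [Finset.mem_subtype, Finset.mem_erase, Set.Finite.mem_toFinset] at hl ⊢
    exact ⟨hl.1, hl.2.1, hl.2.2.trans hR⟩
  have ht := tendsto_atTop_finset_of_monotone hmono fun l => ⟨‖(l : CInf F)‖, by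
    simp only [Finset.mem_subtype, Finset.mem_erase, Set.Finite.mem_toFinset]
    exact ⟨l.2.2, l.2.1, le_rfl⟩⟩
  refine (h.comp ht).congr fun R => ?_
  refine Finset.prod_subtype_of_mem (fun l => 1 - z / l) fun l hl => ?_
  simp only [Finset.mem_erase, Set.Finite.mem_toFinset] at hl
  exact ⟨hl.2.1, hl.1⟩

theorem exists_linearMap_eq_latticeExp :
    ∃ f : CInf F →ₗ[F] CInf F, ∀ z, f z = latticeExp Λ z := by
  classical
  -- For `R < 0` the ball is empty and not a subspace, so a dummy map is used there.
  have h (R : ℝ) : ∃ f : CInf F →ₗ[F] CInf F, 0 ≤ R → ∀ z, f z = finsetExp (hΛ R).toFinset z := by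
    by_cases hR : 0 ≤ R
    · obtain ⟨f, hf⟩ := exists_linearMap_eq_finsetExp (ballSubmodule Λ hR) (hΛ R).toFinset
        (by simp [ballSubmodule])
      exact ⟨f, fun _ => hf⟩
    · exact ⟨0, fun h => absurd h hR⟩
  choose f hf using h
  have ht (z : CInf F) : Tendsto (fun R => f R z) atTop (𝓝 (latticeExp Λ z)) := by
    refine (tendsto_finsetExp hΛ z).congr' ?_
    filter_upwards [eventually_ge_atTop 0] with R hR
    exact (hf R hR z).symm
  refine ⟨{ toFun := latticeExp Λ, map_add' := fun x y => ?_, map_smul' := fun c x => ?_ },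
    fun z => rfl⟩
  · refine tendsto_nhds_unique (ht _) ?_
    simp only [map_add]
    exact (ht x).add (ht y)
  · refine tendsto_nhds_unique (ht _) ?_
    simp only [map_smul, RingHom.id_apply]
    simp only [Algebra.smul_def]
    exact (ht x).const_mul _

omit hΛ in
theorem latticeExp_zero : latticeExp Λ 0 = 0 := by simp [latticeExp]

omit hΛ in
theorem latticeExp_of_mem {l : CInf F} (hl : l ∈ Λ) : latticeExp Λ l = 0 := by
  rcases eq_or_ne l 0 with rfl | h0
  · exact latticeExp_zero
  · rw [latticeExp, tprod_of_exists_eq_zero ⟨⟨l, hl, h0⟩, by simp [h0]⟩, mul_zero]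

/-- Each factor `1 - z / l` is within `‖z‖ / ρ` of 1, hence so is the product. The error is
quadratic in `z`, which makes `T^n e(l / T^n)` converge to `l`. -/
theorem norm_latticeExp_sub_le {ρ : ℝ} (hρ : 0 < ρ) (h : ∀ l ∈ Λ, l ≠ 0 → ρ ≤ ‖l‖) {z : CInf F}
    (hz : ‖z‖ ≤ ρ) : ‖latticeExp Λ z - z‖ ≤ ‖z‖ * (‖z‖ / ρ) := by
  classical
  refine le_of_tendsto ((tendsto_finsetExp hΛ z).sub_const z).norm
    (Eventually.of_forall fun R => ?_)
  rw [finsetExp, ← mul_sub_one, norm_mul]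
  refine mul_le_mul_of_nonneg_left ?_ (norm_nonneg _)
  simp_rw [sub_eq_add_neg (1 : CInf F)]
  refine norm_prod_one_add_sub_one_le _ _ (by positivity) (div_le_one_of_le₀ hz hρ.le) ?_
  intro l hl
  simp only [Finset.mem_erase, Set.Finite.mem_toFinset] at hl
  rw [norm_neg, norm_div]
  exact div_le_div_of_nonneg_left (norm_nonneg _) hρ (h l hl.2.1 hl.1)

theorem exists_pos_le_norm : ∃ ρ : ℝ, 0 < ρ ∧ ∀ l ∈ Λ, l ≠ 0 → ρ ≤ ‖l‖ := by
  classical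
  by_cases hne : ((hΛ 1).toFinset.erase 0).Nonempty
  · obtain ⟨m, hm, hmin⟩ := Finset.exists_min_image _ (fun l : CInf F => ‖l‖) hne
    simp only [Finset.mem_erase, Set.Finite.mem_toFinset] at hm hmin
    refine ⟨‖m‖, norm_pos_iff.2 hm.1, fun l hl hl0 => ?_⟩
    by_cases hl1 : ‖l‖ ≤ 1
    · exact hmin l ⟨hl0, hl, hl1⟩
    · exact hm.2.2.trans (not_le.1 hl1).le
  · refine ⟨1, one_pos, fun l hl hl0 => ?_⟩
    by_contra! hlt
    exact hne ⟨l, by simp only [Finset.mem_erase, Set.Finite.mem_toFinset]; exact ⟨hl0, hl, hlt.le⟩⟩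

/-- An infinite product could tend to 0 without a zero factor. Here factors with `‖l‖ > ‖z‖` have
norm 1, so the norm equals that of a finite product. -/
theorem latticeExp_eq_zero_iff (z : CInf F) : latticeExp Λ z = 0 ↔ z ∈ Λ := by
  classical
  refine ⟨fun h => ?_, latticeExp_of_mem⟩
  by_contra hz
  have h0 (R : ℝ) (hR : 0 ≤ R) : 0 ∈ (hΛ R).toFinset := by
    simp only [Set.Finite.mem_toFinset]
    exact ⟨Λ.zero_mem, by simpa⟩
  -- Beyond the radius `‖z‖` the norm of the partial products does not change.
  have hconst (R : ℝ) (hR : ‖z‖ ≤ R) :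
      ‖finsetExp (hΛ R).toFinset z‖ = ‖finsetExp (hΛ ‖z‖).toFinset z‖ := by
    rw [finsetExp, finsetExp, norm_mul, norm_mul, norm_prod, norm_prod]
    congr 1
    symm
    refine Finset.prod_subset (fun l hl => ?_) fun l hl hl' => ?_
    · simp only [Finset.mem_erase, Set.Finite.mem_toFinset] at hl ⊢
      exact ⟨hl.1, hl.2.1, hl.2.2.trans hR⟩
    · simp only [Finset.mem_erase, Set.Finite.mem_toFinset] at hl hl'
      have hlt : ‖z‖ < ‖l‖ := by
        by_contra! hle
        exact hl' ⟨hl.1, hl.2.1, hle⟩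
      have h1 : ‖z / l‖ < 1 := by
        rw [norm_div, div_lt_one (norm_pos_iff.2 hl.1)]
        exact hlt
      rw [sub_eq_add_neg, IsUltrametricDist.norm_add_eq_max_of_norm_ne_norm, norm_one, norm_neg,
        max_eq_left h1.le]
      rw [norm_one, norm_neg]
      exact h1.ne'
  have hlim : ‖latticeExp Λ z‖ = ‖finsetExp (hΛ ‖z‖).toFinset z‖ := by
    refine tendsto_nhds_unique (tendsto_finsetExp hΛ z).norm ?_
    refine tendsto_const_nhds.congr' ?_
    filter_upwards [eventually_ge_atTop ‖z‖] with R hR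
    exact (hconst R hR).symm
  rw [h, norm_zero, eq_comm, norm_eq_zero, finsetExp_eq_zero_iff (h0 _ (norm_nonneg _)),
    Set.Finite.mem_toFinset] at hlim
  exact hz hlim.1

theorem latticeExp_mem (M : Subfield (CInf F)) (hM : IsClosed (M : Set (CInf F)))
    (hΛM : ∀ l ∈ Λ, l ∈ M) {z : CInf F} (hz : z ∈ M) : latticeExp Λ z ∈ M := by
  classical
  refine hM.mem_of_tendsto (tendsto_finsetExp hΛ z) (Eventually.of_forall fun R => ?_)
  refine M.mul_mem hz (M.prod_mem fun l hl => M.sub_mem M.one_mem (M.div_mem hz (hΛM l ?_)))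
  simp only [Finset.mem_erase, Set.Finite.mem_toFinset] at hl
  exact hl.2.1

end LatticeExp

variable {F : Type*} [Field F] [Fintype F]

/-! ### Norms of polynomials in `T`. -/

section Norms

theorem CInf.T_ne_zero : CInf.T F ≠ 0 := by
  rw [← norm_pos_iff, CInf.norm_T]
  exact_mod_cast Fintype.card_pos

theorem algebraMap_X_eq_T : algebraMap F[X] (CInf F) X = CInf.T F := by
  rw [← mul_one (CInf.T F), ← CInf.X_smul, Algebra.smul_def, mul_one]

theorem algebraMap_C_eq (c : F) : algebraMap F[X] (CInf F) (C c) = algebraMap F (CInf F) c := by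
  rw [IsScalarTower.algebraMap_apply F F[X] (CInf F), Polynomial.algebraMap_eq]

theorem norm_algebraMap_poly {a : F[X]} (ha : a ≠ 0) :
    ‖algebraMap F[X] (CInf F) a‖ = (Fintype.card F : ℝ) ^ a.natDegree := by
  have hq : (1 : ℝ) < Fintype.card F := by exact_mod_cast Fintype.one_lt_card
  induction h : a.natDegree generalizing a with
  | zero =>
    rw [eq_C_of_natDegree_eq_zero h] at ha ⊢
    rw [algebraMap_C_eq, norm_algebraMap_constant (by simpa using ha), pow_zero]
  | succ n ih =>
    have hd : a.divX.natDegree = n := by rw [natDegree_divX_eq_natDegree_tsub_one, h]; rfl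
    have hd0 : a.divX ≠ 0 := by
      intro h0
      rw [divX_eq_zero_iff] at h0
      rw [h0, natDegree_C] at h
      omega
    have h1 : ‖algebraMap F[X] (CInf F) (X * a.divX)‖ = (Fintype.card F : ℝ) ^ (n + 1) := by
      rw [map_mul, norm_mul, algebraMap_X_eq_T, CInf.norm_T, ih hd0 hd, pow_succ']
    have h2 : ‖algebraMap F[X] (CInf F) (C (a.coeff 0))‖ ≤ 1 := by
      rw [algebraMap_C_eq]
      rcases eq_or_ne (a.coeff 0) 0 with h0 | h0
      · simp [h0]
      · exact (norm_algebraMap_constant h0).le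
    have h3 : (1 : ℝ) < (Fintype.card F : ℝ) ^ (n + 1) := one_lt_pow₀ hq (by omega)
    conv_lhs => rw [← a.X_mul_divX_add]
    rw [map_add, IsUltrametricDist.norm_add_eq_max_of_norm_ne_norm, h1,
      max_eq_left (h2.trans h3.le)]
    rw [h1]
    exact (h2.trans_lt h3).ne'

theorem algebraMap_poly_ne_zero {a : F[X]} (ha : a ≠ 0) : algebraMap F[X] (CInf F) a ≠ 0 := by
  rw [← norm_pos_iff, norm_algebraMap_poly ha]
  have : (0 : ℝ) < Fintype.card F := by exact_mod_cast Fintype.card_pos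
  positivity

end Norms

/-! ### Finiteness of `L(Λ)` and equality with the torsion field. -/

section PeriodField

variable {L : IntermediateField (KInf F) (CInf F)}

theorem algebraMap_poly_mem (a : F[X]) (M : IntermediateField L (CInf F)) :
    algebraMap F[X] (CInf F) a ∈ M := by
  rw [IsScalarTower.algebraMap_apply F[X] (KInf F) (CInf F)]
  exact M.algebraMap_mem (algebraMap (KInf F) L (algebraMap F[X] (KInf F) a))

theorem T_mem (M : IntermediateField L (CInf F)) : CInf.T F ∈ M := by
  rw [← algebraMap_X_eq_T]
  exact algebraMap_poly_mem _ _

theorem isClosed_of_finiteDimensional [FiniteDimensional (KInf F) L]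
    (M : IntermediateField L (CInf F)) [FiniteDimensional L M] : IsClosed (M : Set (CInf F)) := by
  have h1 : FiniteDimensional (KInf F) M := Module.Finite.trans L M
  let S : Submodule (KInf F) (CInf F) :=
    Subalgebra.toSubmodule (IntermediateField.toSubalgebra (M.restrictScalars (KInf F)))
  have h2 : FiniteDimensional (KInf F) S := h1
  exact Submodule.closed_of_finiteDimensional S

namespace DrinfeldModule

variable {r : ℕ} (φ : DrinfeldModule L r)

theorem opT_apply (z : CInf F) :
    φ.opT z = ∑ i : Fin (r + 1), (φ.coeff i : CInf F) * z ^ Fintype.card F ^ (i : ℕ) := rfl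

theorem op_C (c : F) (z : CInf F) : φ.op (C c) z = c • z := by
  simp [op]

theorem op_X_mul (a : F[X]) (z : CInf F) : φ.op (X * a) z = φ.op a (φ.opT z) := by
  rw [mul_comm]
  simp [op]

theorem exists_poly_opT :
    ∃ P : L[X], P.natDegree = Fintype.card F ^ r ∧ ∀ z : CInf F, φ.opT z = aeval z P := by
  refine ⟨∑ i : Fin (r + 1), C (φ.coeff i) * X ^ Fintype.card F ^ (i : ℕ), ?_, fun z => ?_⟩
  · have hq : 1 < Fintype.card F := Fintype.one_lt_card
    refine natDegree_eq_of_le_of_coeff_ne_zero ?_ ?_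
    · refine natDegree_sum_le_of_forall_le _ _ fun i _ => (natDegree_C_mul_X_pow_le _ _).trans ?_
      exact Nat.pow_le_pow_right hq.le (Nat.lt_succ_iff.1 i.2)
    · rw [finsetSum_coeff, Finset.sum_eq_single (Fin.last r)]
      · simpa using φ.coeff_last
      · intro i _ hi
        rw [coeff_C_mul_X_pow, if_neg]
        intro h
        exact hi (Fin.ext (Nat.pow_right_injective hq h).symm)
      · simp
  · rw [opT_apply, map_sum]
    simp only [map_mul, map_pow, aeval_C, aeval_X]
    rfl

/-- The operator `φ_a` is given by a polynomial of degree `q ^ (r deg a)` over `L`. -/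
theorem exists_poly_op (hr : r ≠ 0) {a : F[X]} (ha : a ≠ 0) :
    ∃ P : L[X], P.natDegree = Fintype.card F ^ (r * a.natDegree) ∧
      ∀ z : CInf F, φ.op a z = aeval z P := by
  have hq : 1 < Fintype.card F := Fintype.one_lt_card
  have hF (c : F) : ∃ x : L, algebraMap L (CInf F) x = algebraMap F (CInf F) c :=
    ⟨algebraMap (KInf F) L (algebraMap F (KInf F) c), by
      rw [IsScalarTower.algebraMap_apply F (KInf F) (CInf F)]; rfl⟩
  induction h : a.natDegree generalizing a with
  | zero =>
    rw [eq_C_of_natDegree_eq_zero h] at ha ⊢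
    obtain ⟨x, hx⟩ := hF (a.coeff 0)
    have hx0 : x ≠ 0 := by
      rintro rfl
      rw [map_zero, eq_comm, map_eq_zero] at hx
      rw [hx, C_0] at ha
      exact ha rfl
    refine ⟨C x * X, by rw [natDegree_C_mul_X _ hx0]; simp, fun z => ?_⟩
    rw [op_C, map_mul, aeval_C, aeval_X, hx, Algebra.smul_def]
  | succ n ih =>
    have hd : a.divX.natDegree = n := by rw [natDegree_divX_eq_natDegree_tsub_one, h]; rfl
    have hd0 : a.divX ≠ 0 := by
      intro h0
      rw [divX_eq_zero_iff] at h0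
      rw [h0, natDegree_C] at h
      omega
    obtain ⟨Q, hQ, hQz⟩ := ih hd0 hd
    obtain ⟨P, hP, hPz⟩ := φ.exists_poly_opT
    obtain ⟨x, hx⟩ := hF (a.coeff 0)
    refine ⟨Q.comp P + C x * X, ?_, fun z => ?_⟩
    · have h1 : (Q.comp P).natDegree = Fintype.card F ^ (r * (n + 1)) := by
        rw [natDegree_comp, hQ, hP, ← pow_add]
        rfl
      rw [natDegree_add_eq_left_of_natDegree_lt, h1]
      rw [h1]
      exact ((natDegree_C_mul_le _ _).trans natDegree_X_le).trans_lt
        (Nat.one_lt_pow (Nat.mul_ne_zero hr (by omega)) hq)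
    · conv_lhs => rw [← a.X_mul_divX_add]
      rw [map_add, LinearMap.add_apply, op_X_mul, op_C, hQz, hPz, map_add, aeval_comp, map_mul,
        aeval_C, aeval_X, hx, Algebra.smul_def]

theorem isAlgebraic_of_mem_tor (hr : r ≠ 0) {z : CInf F} (hz : z ∈ φ.tor) : IsAlgebraic L z := by
  simp only [tor, Set.mem_iUnion] at hz
  obtain ⟨a, ha, hz⟩ := hz
  obtain ⟨P, hP, hPz⟩ := φ.exists_poly_op hr ha
  refine ⟨P, ?_, by rw [← hPz]; exact hz⟩
  rintro rfl
  rw [natDegree_zero] at hP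
  exact (pow_pos Fintype.card_pos _).ne hP

/-- For `‖d‖ ≤ 1 / G ≤ 1` each higher term is at most `G ‖d‖² ≤ ‖d‖`, while the linear term `T d`
has norm `q ‖d‖`. Dividing by `T` therefore gives a contraction. -/
theorem exists_norm_opT_sub_le :
    ∃ ρ : ℝ, 0 < ρ ∧ ∀ d : CInf F, ‖d‖ ≤ ρ → ‖φ.opT d - CInf.T F * d‖ ≤ ‖d‖ := by
  have hq : 1 < Fintype.card F := Fintype.one_lt_card
  set G : ℝ := 1 + ∑ i : Fin (r + 1), ‖(φ.coeff i : CInf F)‖ with hG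
  have hG1 : 1 ≤ G := le_add_of_nonneg_right (Finset.sum_nonneg fun _ _ => norm_nonneg _)
  refine ⟨G⁻¹, by positivity, fun d hd => ?_⟩
  have hd1 : ‖d‖ ≤ 1 := hd.trans (inv_le_one_of_one_le₀ hG1)
  have h0 : (φ.coeff 0 : CInf F) = CInf.T F := by rw [φ.coeff_zero]; rfl
  rw [opT_apply, Fin.sum_univ_succ, h0]
  simp only [Fin.val_zero, pow_zero, pow_one, add_sub_cancel_left]
  refine IsUltrametricDist.norm_sum_le_of_forall_le_of_nonneg (norm_nonneg _) fun i _ => ?_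
  rw [norm_mul, norm_pow]
  have h1 : ‖(φ.coeff i.succ : CInf F)‖ ≤ G := by
    refine le_trans ?_ (le_add_of_nonneg_left zero_le_one)
    exact Finset.single_le_sum (f := fun i => ‖(φ.coeff i : CInf F)‖)
      (fun _ _ => norm_nonneg _) (Finset.mem_univ _)
  have h2 : ‖d‖ ^ Fintype.card F ^ (i.succ : ℕ) ≤ ‖d‖ ^ 2 :=
    pow_le_pow_of_le_one (norm_nonneg _) hd1 (Nat.one_lt_pow (by simp) hq)
  calc ‖(φ.coeff i.succ : CInf F)‖ * ‖d‖ ^ Fintype.card F ^ (i.succ : ℕ)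
      ≤ G * (‖d‖ * G⁻¹) := by
        refine mul_le_mul h1 (h2.trans ?_) (by positivity) (by positivity)
        rw [pow_two]
        exact mul_le_mul_of_nonneg_left hd (norm_nonneg _)
    _ = ‖d‖ := by field_simp

/-- A small solution `x` of `φ_T(x) = y` lies in every closed field that contains `y`. -/
theorem mem_of_opT_mem {ρ : ℝ} (hρ : ∀ d : CInf F, ‖d‖ ≤ ρ → ‖φ.opT d - CInf.T F * d‖ ≤ ‖d‖)
    (M : IntermediateField L (CInf F)) (hM : IsClosed (M : Set (CInf F))) {x : CInf F}
    (hx : ‖x‖ ≤ ρ) (hxM : φ.opT x ∈ M) : x ∈ M := by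
  have hq : (1 : ℝ) < Fintype.card F := by exact_mod_cast Fintype.one_lt_card
  have hopT {z : CInf F} (hz : z ∈ M) : φ.opT z ∈ M := by
    rw [opT_apply]
    exact M.sum_mem fun i _ => M.mul_mem (M.algebraMap_mem (φ.coeff i)) (pow_mem hz _)
  -- Fixed point iteration for `T v = φ_T(x) - (φ_T(v) - T v)`, which `x` solves. It stays in `M`
  -- because only `φ_T(x)`, not `x`, enters.
  let u : ℕ → CInf F := fun k => k.rec 0 fun _ v =>
    (φ.opT x - (φ.opT v - CInf.T F * v)) / CInf.T F
  have hsucc (k : ℕ) : u (k + 1) = (φ.opT x - (φ.opT (u k) - CInf.T F * u k)) / CInf.T F := rfl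
  have hu (k : ℕ) : u k ∈ M := by
    induction k with
    | zero => exact M.zero_mem
    | succ k ih =>
      rw [hsucc]
      exact M.div_mem (M.sub_mem hxM (M.sub_mem (hopT ih) (M.mul_mem (T_mem M) ih))) (T_mem M)
  have hnorm (k : ℕ) : ‖u k - x‖ ≤ ‖x‖ * ((Fintype.card F : ℝ)⁻¹) ^ k := by
    induction k with
    | zero => simp [u]
    | succ k ih =>
      have h1 : ‖x - u k‖ ≤ ‖x‖ * ((Fintype.card F : ℝ)⁻¹) ^ k := by rwa [norm_sub_rev]
      have h2 : ‖x - u k‖ ≤ ρ := h1.trans ((mul_le_of_le_one_right (norm_nonneg _)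
        (pow_le_one₀ (by positivity) (inv_le_one_of_one_le₀ hq.le))).trans hx)
      -- Additivity of `φ_T` expresses the new error through the old one, which shrinks by a factor
      -- `1 / q`.
      have h3 : u (k + 1) - x = (φ.opT (x - u k) - CInf.T F * (x - u k)) / CInf.T F := by
        rw [hsucc, map_sub, div_sub' CInf.T_ne_zero]
        congr 1
        ring
      rw [h3, norm_div, CInf.norm_T, pow_succ, ← mul_assoc, div_eq_mul_inv]
      exact mul_le_mul_of_nonneg_right ((hρ _ h2).trans h1) (by positivity)
  have hlim : Tendsto u atTop (𝓝 x) := by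
    rw [tendsto_iff_norm_sub_tendsto_zero]
    refine squeeze_zero (fun _ => norm_nonneg _) hnorm ?_
    simpa using (tendsto_pow_atTop_nhds_zero_of_lt_one (by positivity)
      (inv_lt_one_of_one_lt₀ hq)).const_mul ‖x‖
  exact hM.mem_of_tendsto hlim (Eventually.of_forall hu)

end DrinfeldModule

section PeriodLattice

variable {r : ℕ} {φ : DrinfeldModule L r} {Λ : Submodule F[X] (CInf F)} (h : IsPeriodLattice φ Λ)

include h

theorem IsPeriodLattice.op_latticeExp (a : F[X]) (z : CInf F) :
    φ.op a (latticeExp Λ z) = latticeExp Λ (a • z) := by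
  obtain ⟨e, he⟩ := exists_linearMap_eq_latticeExp h.isLattice.discrete
  have hX (z : CInf F) : latticeExp Λ ((X : F[X]) • z) = φ.opT (latticeExp Λ z) := by
    rw [CInf.X_smul, h.latticeExp_T_mul]
  induction a using Polynomial.induction_on generalizing z with
  | C c =>
    rw [φ.op_C, ← he, ← he, ← map_smul]
    congr 1
    rw [← smul_one_smul F[X] c z, smul_eq_C_mul, mul_one]
  | add a b ha hb => rw [map_add, LinearMap.add_apply, ha, hb, add_smul, ← he, ← he, ← he, map_add]
  | monomial n c ih =>
    rw [show C c * X ^ (n + 1) = X * (C c * X ^ n) by ring, φ.op_X_mul, ← hX, ih, smul_smul,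
      mul_comm]

theorem IsPeriodLattice.latticeExp_div_mem_divisionPoints {l : CInf F} (hl : l ∈ Λ) {a : F[X]}
    (ha : a ≠ 0) : latticeExp Λ (l / algebraMap F[X] (CInf F) a) ∈ φ.divisionPoints a := by
  change φ.op a _ = 0
  rw [h.op_latticeExp, Algebra.smul_def, mul_div_cancel₀ _ (algebraMap_poly_ne_zero ha),
    latticeExp_of_mem hl]

/-- Elements `l` whose coordinates have degree `< deg a` represent `Λ / aΛ`. They give `q^(r deg a)`
distinct division points, as many as the degree of `φ_a` permits. -/
theorem IsPeriodLattice.exists_eq_latticeExp_div (hr : r ≠ 0) {a : F[X]} (ha : a ≠ 0) {z : CInf F}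
    (hz : z ∈ φ.divisionPoints a) :
    ∃ l ∈ Λ, z = latticeExp Λ (l / algebraMap F[X] (CInf F) a) := by
  classical
  have hd := h.isLattice.discrete
  have := h.isLattice.free
  have := h.isLattice.finite
  obtain ⟨e, he⟩ := exists_linearMap_eq_latticeExp hd
  obtain ⟨P, hP, hPz⟩ := φ.exists_poly_op hr ha
  have hP0 : P ≠ 0 := by
    rintro rfl
    rw [natDegree_zero] at hP
    exact (pow_pos Fintype.card_pos _).ne hP
  have ha' := algebraMap_poly_ne_zero ha
  let b : Module.Basis (Fin r) F[X] Λ := Module.finBasisOfFinrankEq F[X] Λ h.isLattice.finrank_eq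
  let p : (Fin r → Fin a.natDegree → F) → Fin r → F[X] :=
    fun c i => ((degreeLTEquiv F a.natDegree).symm (c i) : F[X])
  let l : (Fin r → Fin a.natDegree → F) → Λ := fun c => b.equivFun.symm (p c)
  let g : (Fin r → Fin a.natDegree → F) → CInf F :=
    fun c => latticeExp Λ ((l c : CInf F) / algebraMap F[X] (CInf F) a)
  have hinj : Function.Injective g := by
    intro c c' hcc
    have h1 : ((l c : CInf F) - l c') / algebraMap F[X] (CInf F) a ∈ Λ := by
      rw [← latticeExp_eq_zero_iff hd, sub_div, ← he, map_sub, he, he, sub_eq_zero]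
      exact hcc
    have h2 : l c - l c' = a • (⟨_, h1⟩ : Λ) := by
      ext
      rw [Submodule.coe_smul, Algebra.smul_def, mul_div_cancel₀ _ ha']
      rfl
    have h3 (i : Fin r) : p c i - p c' i = a * b.equivFun ⟨_, h1⟩ i := by
      have := congrArg (fun x => b.equivFun x i) h2
      simpa only [l, map_sub, map_smul, LinearEquiv.apply_symm_apply, Pi.sub_apply, Pi.smul_apply,
        smul_eq_mul] using this
    funext i
    have h4 : p c i - p c' i = 0 := by
      refine eq_zero_of_dvd_of_degree_lt ⟨_, h3 i⟩ ?_
      rw [degree_eq_natDegree ha]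
      exact mem_degreeLT.1 (Submodule.sub_mem _ (Subtype.coe_prop _) (Subtype.coe_prop _))
    exact (degreeLTEquiv F a.natDegree).symm.injective (Subtype.ext (sub_eq_zero.1 h4))
  have hmem (x : CInf F) (hx : x ∈ φ.divisionPoints a) : x ∈ P.aroots (CInf F) := by
    refine (mem_roots (Polynomial.map_ne_zero hP0)).2 ?_
    rw [IsRoot, eval_map_algebraMap, ← hPz]
    exact hx
  have hsub : Finset.univ.image g ⊆ (P.aroots (CInf F)).toFinset := by
    intro x hx
    obtain ⟨c, -, rfl⟩ := Finset.mem_image.1 hx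
    exact Multiset.mem_toFinset.2
      (hmem _ (h.latticeExp_div_mem_divisionPoints (Subtype.coe_prop _) ha))
  have heq : Finset.univ.image g = (P.aroots (CInf F)).toFinset := by
    refine Finset.eq_of_subset_of_card_le hsub ?_
    rw [Finset.card_image_of_injective _ hinj, Finset.card_univ]
    refine (Multiset.toFinset_card_le _).trans ((card_roots' _).trans (natDegree_map_le.trans ?_))
    rw [hP]
    simp [pow_mul, pow_right_comm]
  have hz' : z ∈ Finset.univ.image g := by
    rw [heq]
    exact Multiset.mem_toFinset.2 (hmem z hz)
  obtain ⟨c, -, rfl⟩ := Finset.mem_image.1 hz'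
  exact ⟨l c, Subtype.coe_prop _, rfl⟩

variable [FiniteDimensional (KInf F) L]

theorem IsPeriodLattice.exists_tor_mem_adjoin (hr : r ≠ 0) {l : CInf F} (hl : l ∈ Λ) :
    ∃ x ∈ φ.tor, l ∈ IntermediateField.adjoin L {x} := by
  have hq : (1 : ℝ) < Fintype.card F := by exact_mod_cast Fintype.one_lt_card
  have hd := h.isLattice.discrete
  obtain ⟨ρ, hρ0, hρ⟩ := exists_pos_le_norm hd
  obtain ⟨ρ', hρ'0, hρ'⟩ := φ.exists_norm_opT_sub_le
  have hT := CInf.T_ne_zero (F := F)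
  set y : ℕ → CInf F := fun n => latticeExp Λ (l / CInf.T F ^ n) with hy
  have hnorm (n : ℕ) : ‖l / CInf.T F ^ n‖ = ‖l‖ * ((Fintype.card F : ℝ)⁻¹) ^ n := by
    rw [norm_div, norm_pow, CInf.norm_T, div_eq_mul_inv, inv_pow]
  have hlim0 : Tendsto (fun n : ℕ => ‖l‖ * ((Fintype.card F : ℝ)⁻¹) ^ n) atTop (𝓝 0) := by
    simpa using (tendsto_pow_atTop_nhds_zero_of_lt_one (by positivity)
      (inv_lt_one_of_one_lt₀ hq)).const_mul ‖l‖
  obtain ⟨n₀, hn₀⟩ := eventually_atTop.1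
    ((hlim0.eventually (gt_mem_nhds hρ0)).and (hlim0.eventually (gt_mem_nhds hρ'0)))
  have hsub (n : ℕ) (hn : n₀ ≤ n) : ‖y n - l / CInf.T F ^ n‖ ≤
      ‖l / CInf.T F ^ n‖ * (‖l / CInf.T F ^ n‖ / ρ) :=
    norm_latticeExp_sub_le hd hρ0 hρ (by rw [hnorm]; exact (hn₀ n hn).1.le)
  have hyρ (n : ℕ) (hn : n₀ ≤ n) : ‖y n‖ ≤ ρ' := by
    have h1 : ‖l / CInf.T F ^ n‖ ≤ ρ' := by rw [hnorm]; exact (hn₀ n hn).2.le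
    have h2 : ‖l / CInf.T F ^ n‖ / ρ ≤ 1 :=
      div_le_one_of_le₀ (by rw [hnorm]; exact (hn₀ n hn).1.le) hρ0.le
    rw [← sub_add_cancel (y n) (l / CInf.T F ^ n)]
    exact (IsUltrametricDist.norm_add_le_max _ _).trans (max_le
      ((hsub n hn).trans ((mul_le_of_le_one_right (norm_nonneg _) h2).trans h1)) h1)
  have hyT (n : ℕ) : φ.opT (y (n + 1)) = y n := by
    rw [hy, ← h.latticeExp_T_mul]
    congr 1
    field_simp
    ring
  have htor : y n₀ ∈ φ.tor := by
    have h1 : (X ^ n₀ : F[X]) ≠ 0 := pow_ne_zero _ X_ne_zero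
    have h2 := h.latticeExp_div_mem_divisionPoints hl h1
    rw [map_pow, algebraMap_X_eq_T] at h2
    exact Set.mem_iUnion₂.2 ⟨_, h1, h2⟩
  refine ⟨y n₀, htor, ?_⟩
  have := IntermediateField.adjoin.finiteDimensional (φ.isAlgebraic_of_mem_tor hr htor).isIntegral
  set M := IntermediateField.adjoin L {y n₀} with hMdef
  have hM : IsClosed (M : Set (CInf F)) := isClosed_of_finiteDimensional M
  -- Beyond `n₀` each `y (n + 1)` is a small preimage of `y n`, so no further field extension is
  -- needed.
  have hyM (n : ℕ) (hn : n₀ ≤ n) : y n ∈ M := by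
    induction n, hn using Nat.le_induction with
    | base => exact IntermediateField.mem_adjoin_simple_self L _
    | succ n hn ih =>
      exact φ.mem_of_opT_mem hρ' M hM (hyρ _ (by omega)) (by rwa [hyT])
  have hlim : Tendsto (fun n => CInf.T F ^ n * y n) atTop (𝓝 l) := by
    rw [tendsto_iff_norm_sub_tendsto_zero]
    refine squeeze_zero' (Eventually.of_forall fun _ => norm_nonneg _)
      (g := fun n => ‖l‖ * ((‖l‖ * ((Fintype.card F : ℝ)⁻¹) ^ n) / ρ)) ?_ ?_
    · filter_upwards [eventually_ge_atTop n₀] with n hn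
      have h1 : CInf.T F ^ n * y n - l = CInf.T F ^ n * (y n - l / CInf.T F ^ n) := by
        field_simp
      have h2 : ‖CInf.T F ^ n‖ * ‖l / CInf.T F ^ n‖ = ‖l‖ := by
        rw [← norm_mul, mul_div_cancel₀ _ (pow_ne_zero n hT)]
      rw [h1, norm_mul, ← hnorm n]
      refine (mul_le_mul_of_nonneg_left (hsub n hn) (norm_nonneg _)).trans_eq ?_
      rw [← mul_assoc, h2]
    · simpa using (hlim0.div_const ρ).const_mul ‖l‖
  refine hM.mem_of_tendsto hlim ?_
  filter_upwards [eventually_ge_atTop n₀] with n hn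
  exact M.mul_mem (pow_mem (T_mem M) n) (hyM n hn)

theorem IsPeriodLattice.finiteDimensional_adjoin (hr : r ≠ 0) :
    FiniteDimensional L (IntermediateField.adjoin L (Λ : Set (CInf F))) := by
  have := h.isLattice.free
  have := h.isLattice.finite
  let b : Module.Basis (Fin r) F[X] Λ := Module.finBasisOfFinrankEq F[X] Λ h.isLattice.finrank_eq
  have heq : IntermediateField.adjoin L (Λ : Set (CInf F)) =
      IntermediateField.adjoin L (Set.range fun i => (b i : CInf F)) := by
    refine le_antisymm (IntermediateField.adjoin_le_iff.2 fun l hl => ?_)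
      (IntermediateField.adjoin.mono _ _ _ ?_)
    · have h1 : l = ∑ i, b.equivFun ⟨l, hl⟩ i • (b i : CInf F) := by
        have := congrArg Λ.subtype (b.sum_equivFun ⟨l, hl⟩)
        rw [map_sum] at this
        simpa only [map_smul, Submodule.subtype_apply] using this.symm
      rw [SetLike.mem_coe, h1]
      refine sum_mem fun i _ => ?_
      rw [Algebra.smul_def]
      exact mul_mem (algebraMap_poly_mem _ _) (IntermediateField.subset_adjoin _ _ ⟨i, rfl⟩)
    · rintro _ ⟨i, rfl⟩
      exact (b i).2
  rw [heq]
  refine IntermediateField.finiteDimensional_adjoin ?_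
  rintro _ ⟨i, rfl⟩
  obtain ⟨x, hx, hmem⟩ := h.exists_tor_mem_adjoin hr (b i).2
  have hint := (φ.isAlgebraic_of_mem_tor hr hx).isIntegral
  have := IntermediateField.adjoin.finiteDimensional hint
  have h2 : IsIntegral L (⟨_, hmem⟩ : IntermediateField.adjoin L {x}) := IsIntegral.of_finite L _
  exact h2.map (IntermediateField.val _)

theorem IsPeriodLattice.adjoin_eq_adjoin_tor (hr : r ≠ 0) :
    IntermediateField.adjoin L (Λ : Set (CInf F)) = IntermediateField.adjoin L φ.tor := by
  have := h.finiteDimensional_adjoin hr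
  refine le_antisymm (IntermediateField.adjoin_le_iff.2 fun l hl => ?_)
    (IntermediateField.adjoin_le_iff.2 fun z hz => ?_)
  · obtain ⟨x, hx, hmem⟩ := h.exists_tor_mem_adjoin hr hl
    exact IntermediateField.adjoin.mono _ _ _ (Set.singleton_subset_iff.2 hx) hmem
  · obtain ⟨a, ha, hz⟩ := Set.mem_iUnion₂.1 hz
    obtain ⟨l, hl, rfl⟩ := h.exists_eq_latticeExp_div hr ha hz
    -- `L(Λ)` is closed and contains `Λ`, so it is stable under `e`.
    refine latticeExp_mem h.isLattice.discrete
      (IntermediateField.adjoin L (Λ : Set (CInf F))).toSubfield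
      (isClosed_of_finiteDimensional _) (fun l hl => IntermediateField.subset_adjoin _ _ hl) ?_
    exact div_mem (IntermediateField.subset_adjoin L _ hl) (algebraMap_poly_mem _ _)

end PeriodLattice

end PeriodField

/-! ### The functional equation of `e` under `z ↦ T z`. -/

section FunctionalEquation

variable {Λ : Submodule F[X] (CInf F)} {r : ℕ} (b : Module.Basis (Fin r) F[X] Λ)

theorem constant_smul_mem {l : CInf F} (hl : l ∈ Λ) (c : F) : c • l ∈ Λ :=
  (Λ.restrictScalars F).smul_mem c hl

/-- Every element of `Λ` is a `T`-multiple in `Λ` plus an `F`-combination of the basis. -/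
theorem exists_eq_T_mul_add {l : CInf F} (hl : l ∈ Λ) :
    ∃ m ∈ Λ, ∃ a : Fin r → F, l = CInf.T F * m + ∑ i, a i • (b i : CInf F) := by
  have h1 : l = ∑ i, b.equivFun ⟨l, hl⟩ i • (b i : CInf F) := by
    have := congrArg Λ.subtype (b.sum_equivFun ⟨l, hl⟩)
    rw [map_sum] at this
    simpa only [map_smul, Submodule.subtype_apply] using this.symm
  refine ⟨∑ i, (b.equivFun ⟨l, hl⟩ i).divX • (b i : CInf F),
    sum_mem fun i _ => Λ.smul_mem _ (b i).2, fun i => (b.equivFun ⟨l, hl⟩ i).coeff 0, ?_⟩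
  conv_lhs => rw [h1]
  rw [← CInf.X_smul, Finset.smul_sum, ← Finset.sum_add_distrib]
  refine Finset.sum_congr rfl fun i _ => ?_
  conv_lhs => rw [← X_mul_divX_add (b.equivFun ⟨l, hl⟩ i)]
  rw [add_smul, mul_smul]
  congr 1
  rw [Algebra.smul_def, algebraMap_C_eq, Algebra.smul_def]

/-- Compare constant coefficients in the basis. With `exists_eq_T_mul_add`, the sums divided by `T`
represent `T⁻¹Λ / Λ` exactly once. -/
theorem eq_zero_of_sum_div_T_mem {a : Fin r → F}
    (h : (∑ i, a i • (b i : CInf F)) / CInf.T F ∈ Λ) : a = 0 := by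
  have h1 : ∑ i, C (a i) • b i = (X : F[X]) • (⟨_, h⟩ : Λ) := by
    apply Subtype.ext
    rw [Submodule.coe_smul, CInf.X_smul, mul_div_cancel₀ _ CInf.T_ne_zero,
      ← Submodule.subtype_apply, map_sum]
    refine Finset.sum_congr rfl fun i _ => ?_
    rw [map_smul, Submodule.subtype_apply, Algebra.smul_def, algebraMap_C_eq, Algebra.smul_def]
  funext i
  have h2 := congrArg (fun x => (b.equivFun x i).coeff 0) h1
  have h3 : b.equivFun (∑ i, C (a i) • b i) = fun i => C (a i) := by
    rw [← b.equivFun_symm_apply, LinearEquiv.apply_symm_apply]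
  simp only [h3, map_smul, Pi.smul_apply, smul_eq_mul, coeff_C_zero, coeff_X_mul_zero] at h2
  exact h2

variable (hΛ : ∀ R : ℝ, {l : CInf F | l ∈ Λ ∧ ‖l‖ ≤ R}.Finite)

-- `T⁻¹Λ` is the disjoint union of the cosets `s a + Λ`. Once `R` bounds all `‖s a‖`, dividing the
-- ball of radius `q R` in `Λ` by `T` gives the union of the translates by `s a` of the ball of
-- radius `R`. The identity is then finite, and `R → ∞`.
include hΛ in
open Classical in
theorem latticeExp_T_mul_eq_prod (z : CInf F) :
    latticeExp Λ (CInf.T F * z) = CInf.T F * latticeExp Λ z *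
      ∏ a ∈ (Finset.univ.erase 0 : Finset (Fin r → F)),
        (1 - latticeExp Λ z / latticeExp Λ ((∑ i, a i • (b i : CInf F)) / CInf.T F)) := by
  have hT := CInf.T_ne_zero (F := F)
  have hq : (0 : ℝ) < Fintype.card F := by exact_mod_cast Fintype.card_pos
  set s : (Fin r → F) → CInf F := fun a => (∑ i, a i • (b i : CInf F)) / CInf.T F with hs
  have hs0 : s 0 = 0 := by simp [hs]
  have hsub (a a' : Fin r → F) : s a - s a' = s (a - a') := by
    simp only [hs, ← sub_div, ← Finset.sum_sub_distrib, ← sub_smul, Pi.sub_apply]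
  have hsΛ (a : Fin r → F) (ha : s a ∈ Λ) : a = 0 := eq_zero_of_sum_div_T_mem b ha
  have hTs (a : Fin r → F) : CInf.T F * s a ∈ Λ := by
    rw [hs, mul_div_cancel₀ _ hT]
    exact sum_mem fun i _ => constant_smul_mem (b i).2 _
  -- The factor at `v = 0` is 1, since `w / 0 = 0`.
  have hprod (w : CInf F) (t : Finset (CInf F)) :
      finsetExp t w = w * ∏ v ∈ t, (1 - w / v) := by
    rw [finsetExp, Finset.prod_erase _ (by simp)]
  -- the identity for the finite subspaces of elements of bounded norm
  have hfin (R : ℝ) (hR : ∑ a, ‖s a‖ ≤ R) :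
      finsetExp (hΛ (Fintype.card F * R)).toFinset (CInf.T F * z) =
        CInf.T F * finsetExp (hΛ R).toFinset z * ∏ a ∈ (Finset.univ.erase 0 : Finset (Fin r → F)),
          (1 - finsetExp (hΛ R).toFinset z / finsetExp (hΛ R).toFinset (s a)) := by
    have hR' (a : Fin r → F) : ‖s a‖ ≤ R :=
      (Finset.single_le_sum (f := fun a => ‖s a‖) (fun _ _ => norm_nonneg _)
        (Finset.mem_univ a)).trans hR
    have hR0 : 0 ≤ R := (norm_nonneg _).trans (hR' 0)
    have hV : ((hΛ R).toFinset : Set (CInf F)) = ballSubmodule Λ hR0 := by simp [ballSubmodule]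
    have h1 : ∏ l ∈ (hΛ (Fintype.card F * R)).toFinset, (1 - CInf.T F * z / l) =
        ∏ a : Fin r → F, ∏ m ∈ (hΛ R).toFinset, (1 - z / (m + s a)) := by
      rw [← Finset.prod_product']
      symm
      refine Finset.prod_bij (fun x _ => CInf.T F * (x.2 + s x.1)) ?_ ?_ ?_ ?_
      · rintro ⟨a, m⟩ hm
        simp only [Finset.mem_product, Finset.mem_univ, true_and, Set.Finite.mem_toFinset] at hm ⊢
        constructor
        · rw [mul_add, ← CInf.X_smul]
          exact Λ.add_mem (Λ.smul_mem _ hm.1) (hTs a)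
        · rw [norm_mul, CInf.norm_T]
          exact mul_le_mul_of_nonneg_left
            ((IsUltrametricDist.norm_add_le_max _ _).trans (max_le hm.2 (hR' a))) hq.le
      · rintro ⟨a, m⟩ hm ⟨a', m'⟩ hm' heq
        simp only [Finset.mem_product, Finset.mem_univ, true_and, Set.Finite.mem_toFinset]
          at hm hm' heq
        have h2 := mul_left_cancel₀ hT heq
        have h3 : a - a' = 0 := by
          refine hsΛ _ ?_
          rw [← hsub, show s a - s a' = m' - m by linear_combination h2]
          exact Λ.sub_mem hm'.1 hm.1
        obtain rfl := sub_eq_zero.1 h3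
        rw [add_right_cancel h2]
      · intro l hl
        simp only [Set.Finite.mem_toFinset] at hl
        obtain ⟨m, hm, a, rfl⟩ := exists_eq_T_mul_add b hl.1
        have h2 : CInf.T F * m + ∑ i, a i • (b i : CInf F) = CInf.T F * (m + s a) := by
          rw [mul_add, hs, mul_div_cancel₀ _ hT]
        refine ⟨(a, m), ?_, h2.symm⟩
        simp only [Finset.mem_product, Finset.mem_univ, true_and, Set.Finite.mem_toFinset]
        refine ⟨hm, ?_⟩
        have h3 : ‖m + s a‖ ≤ R := by
          have := hl.2
          rw [h2, norm_mul, CInf.norm_T] at this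
          exact le_of_mul_le_mul_left this hq
        rw [← add_sub_cancel_right m (s a), sub_eq_add_neg]
        exact (IsUltrametricDist.norm_add_le_max _ _).trans
          (max_le h3 (by rw [norm_neg]; exact hR' a))
      · rintro ⟨a, m⟩ -
        rw [mul_div_mul_left _ _ hT]
    rw [hprod (CInf.T F * z), h1, ← Finset.mul_prod_erase _ _ (Finset.mem_univ 0), hs0]
    simp only [add_zero]
    rw [← mul_assoc, mul_assoc (CInf.T F), ← hprod]
    congr 1
    refine Finset.prod_congr rfl fun a ha => ?_
    refine prod_one_sub_div_add _ _ hV _ _ fun hmem => ?_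
    simp only [Set.Finite.mem_toFinset] at hmem
    exact Finset.ne_of_mem_erase ha (hsΛ a hmem.1)
  have ht1 := (tendsto_finsetExp hΛ (CInf.T F * z)).comp
    (tendsto_id.const_mul_atTop hq)
  refine tendsto_nhds_unique ht1 (Tendsto.congr' (f₁ := fun R => CInf.T F *
    finsetExp (hΛ R).toFinset z * ∏ a ∈ (Finset.univ.erase 0 : Finset (Fin r → F)),
      (1 - finsetExp (hΛ R).toFinset z / finsetExp (hΛ R).toFinset (s a))) ?_ ?_)
  · filter_upwards [eventually_ge_atTop (∑ a, ‖s a‖)] with R hR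
    exact (hfin R hR).symm
  · refine ((tendsto_finsetExp hΛ z).const_mul _).mul (tendsto_finsetProd _ fun a ha => ?_)
    refine Tendsto.const_sub _ ((tendsto_finsetExp hΛ z).div (tendsto_finsetExp hΛ _) ?_)
    rw [Ne, latticeExp_eq_zero_iff hΛ]
    exact fun hmem => Finset.ne_of_mem_erase ha (hsΛ a hmem)

include hΛ in
theorem latticeExp_sum_div_T (a : Fin r → F) :
    latticeExp Λ ((∑ i, a i • (b i : CInf F)) / CInf.T F) =
      ∑ i, a i • latticeExp Λ ((b i : CInf F) / CInf.T F) := by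
  obtain ⟨e, he⟩ := exists_linearMap_eq_latticeExp hΛ
  rw [← he, Finset.sum_div, map_sum]
  refine Finset.sum_congr rfl fun i _ => ?_
  rw [smul_div_assoc, map_smul, he]

-- The `F`-linear polynomial with roots `e(s a)` is monic, whereas the product in the functional
-- equation is normalized by its linear coefficient `T`; hence the factor `T / c 0`.
include hΛ in
theorem latticeExp_T_mul_eq_sum {c : ℕ → CInf F}
    (hc : ∏ a : Fin r → F, (X - C (∑ i, a i • latticeExp Λ ((b i : CInf F) / CInf.T F))) =
      ∑ i ∈ Finset.range (r + 1), C (c i) * X ^ Fintype.card F ^ i) :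
    c 0 ≠ 0 ∧ ∀ z, latticeExp Λ (CInf.T F * z) =
      ∑ i ∈ Finset.range (r + 1), CInf.T F / c 0 * c i * latticeExp Λ z ^ Fintype.card F ^ i := by
  classical
  have hq : 1 < Fintype.card F := Fintype.one_lt_card
  have hne (a : Fin r → F) (ha : a ∈ (Finset.univ.erase 0 : Finset (Fin r → F))) :
      latticeExp Λ ((∑ i, a i • (b i : CInf F)) / CInf.T F) ≠ 0 := by
    rw [Ne, latticeExp_eq_zero_iff hΛ]
    exact fun hmem => Finset.ne_of_mem_erase ha (eq_zero_of_sum_div_T_mem b hmem)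
  simp only [← latticeExp_sum_div_T b hΛ] at hc
  -- The linear coefficient is the value at 0 of the product with the root 0 removed.
  have h0 : c 0 = ∏ a ∈ (Finset.univ.erase 0 : Finset (Fin r → F)),
      (-latticeExp Λ ((∑ i, a i • (b i : CInf F)) / CInf.T F)) := by
    have h1 := congrArg (fun p => coeff p 1) hc
    simp only [finsetSum_coeff, coeff_C_mul_X_pow] at h1
    rw [Finset.sum_eq_single 0, ← Finset.mul_prod_erase _ _ (Finset.mem_univ 0)] at h1
    · simp only [Pi.zero_apply, zero_smul, Finset.sum_const_zero, zero_div, latticeExp_zero, C_0,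
        sub_zero, coeff_X_mul, coeff_zero_eq_eval_zero, eval_prod, eval_sub, eval_X, eval_C,
        zero_sub, pow_zero, if_true] at h1
      exact h1.symm
    · intro i _ hi
      exact if_neg (Nat.one_lt_pow hi hq).ne
    · simp
  have h00 : c 0 ≠ 0 := by
    rw [h0, Finset.prod_ne_zero_iff]
    exact fun a ha => neg_ne_zero.2 (hne a ha)
  refine ⟨h00, fun z => ?_⟩
  have h1 := congrArg (eval (latticeExp Λ z)) hc
  simp only [eval_prod, eval_sub, eval_X, eval_C, eval_finsetSum, eval_mul, eval_pow] at h1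
  simp only [mul_assoc]
  rw [← Finset.mul_sum, ← h1, ← Finset.mul_prod_erase _ _ (Finset.mem_univ 0),
    latticeExp_T_mul_eq_prod b hΛ z, div_mul_eq_mul_div, mul_assoc, mul_div_assoc]
  congr 1
  simp only [Pi.zero_apply, zero_smul, Finset.sum_const_zero, zero_div, latticeExp_zero, sub_zero]
  rw [mul_div_assoc]
  congr 1
  rw [h0, ← Finset.prod_div_distrib]
  refine Finset.prod_congr rfl fun a ha => ?_
  have := hne a ha
  field_simp
  ring

end FunctionalEquation

/-! ### Galois equivariance of `e`. -/

section Galois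

variable {L : IntermediateField (KInf F) (CInf F)} [FiniteDimensional (KInf F) L]
variable {Λ : Submodule F[X] (CInf F)}

theorem continuous_algEquiv (M : IntermediateField L (CInf F)) [FiniteDimensional L M]
    (σ : M ≃ₐ[L] M) : Continuous σ := by
  have h1 : FiniteDimensional (KInf F) M := Module.Finite.trans L M
  let S : Submodule (KInf F) (CInf F) :=
    Subalgebra.toSubmodule (IntermediateField.toSubalgebra (M.restrictScalars (KInf F)))
  have h2 : FiniteDimensional (KInf F) S := h1
  let f : S →ₗ[KInf F] S :=
    { toFun := fun x => ⟨(σ ⟨x.1, x.2⟩).1, (σ ⟨x.1, x.2⟩).2⟩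
      map_add' := fun x y => Subtype.ext (congrArg Subtype.val (map_add σ ⟨x.1, x.2⟩ ⟨y.1, y.2⟩))
      map_smul' := fun c x => by
        have hc : (⟨(c • x).1, (c • x).2⟩ : M) = algebraMap (KInf F) L c • ⟨x.1, x.2⟩ := by
          apply Subtype.ext
          change c • x.1 = algebraMap (KInf F) L c • x.1
          rw [Algebra.smul_def, Algebra.smul_def]
          rfl
        apply Subtype.ext
        change (σ ⟨(c • x).1, (c • x).2⟩).1 = c • (σ ⟨x.1, x.2⟩).1
        rw [hc, map_smul, Algebra.smul_def, Algebra.smul_def]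
        rfl }
  exact f.continuous_of_finiteDimensional

/-- Being continuous, `σ` passes through the infinite product, and it permutes the factors because
it permutes `Λ`. -/
theorem latticeExp_algEquiv (hΛ : ∀ R : ℝ, {l : CInf F | l ∈ Λ ∧ ‖l‖ ≤ R}.Finite)
    (M : IntermediateField L (CInf F)) [FiniteDimensional L M] (hM : ∀ l ∈ Λ, l ∈ M)
    (σ : M ≃ₐ[L] M) (hσ : ∀ x : M, (σ x : CInf F) ∈ Λ ↔ (x : CInf F) ∈ Λ) (x y : M)
    (hy : (y : CInf F) = latticeExp Λ x) : (σ y : CInf F) = latticeExp Λ (σ x) := by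
  have hcl := isClosed_of_finiteDimensional M
  let I := {l : CInf F // l ∈ Λ ∧ l ≠ 0}
  let toM : I → M := fun l => ⟨l, hM l l.2.1⟩
  have hP := (multipliable_latticeExp hΛ (x : CInf F)).hasProd
  set p := ∏' l : I, (1 - (x : CInf F) / (l : CInf F)) with hp
  have hpM : p ∈ M := hcl.mem_of_tendsto hP (Eventually.of_forall fun s =>
    prod_mem fun l _ => sub_mem M.one_mem (div_mem x.2 (hM l l.2.1)))
  have h1 : HasProd (fun l : I => 1 - x / toM l) (⟨p, hpM⟩ : M) :=
    (Topology.IsInducing.subtypeVal.hasProd_iff (g := M.val) _ _).1 hP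
  have h2 := h1.map σ (continuous_algEquiv M σ)
  have h3 := h2.map M.val continuous_subtype_val
  let τ : I ≃ I :=
    { toFun := fun l => ⟨σ (toM l), (hσ _).2 l.2.1, by
        have := l.2.2
        simpa [toM, Subtype.ext_iff] using this⟩
      invFun := fun l => ⟨σ.symm (toM l), by
          rw [← hσ, AlgEquiv.apply_symm_apply]
          exact l.2.1, by
        have := l.2.2
        simpa [toM, Subtype.ext_iff] using this⟩
      left_inv := fun l => Subtype.ext (by simp [toM])
      right_inv := fun l => Subtype.ext (by simp [toM]) }
  have h4 : HasProd ((fun l : I => 1 - (σ x : CInf F) / (l : CInf F)) ∘ τ)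
      (σ ⟨p, hpM⟩ : CInf F) := by
    convert h3 using 1
    · funext l
      simp [τ, toM]
    · rfl
  rw [τ.hasProd_iff] at h4
  have h5 : y = x * ⟨p, hpM⟩ := Subtype.ext hy
  rw [h5, map_mul, latticeExp, h4.tprod_eq]
  rfl

end Galois

/-! ### Descent of Galois stable lattices to `L`. -/

section Descent

variable {L : IntermediateField (KInf F) (CInf F)} [FiniteDimensional (KInf F) L]
variable {Λ : Submodule F[X] (CInf F)} {r : ℕ}

/-- A lattice that is stable under the Galois group of a finite Galois extension of `L` is the
period lattice of a Drinfeld module over `L`. -/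
theorem exists_drinfeldModule_of_galois (b : Module.Basis (Fin r) F[X] Λ)
    (hΛ : ∀ R : ℝ, {l : CInf F | l ∈ Λ ∧ ‖l‖ ≤ R}.Finite)
    (M : IntermediateField L (CInf F)) [FiniteDimensional L M] [IsGalois L M]
    (hM : ∀ l ∈ Λ, l ∈ M)
    (hσ : ∀ (σ : M ≃ₐ[L] M) (x : M), (x : CInf F) ∈ Λ → (σ x : CInf F) ∈ Λ) :
    ∃ φ : DrinfeldModule L r, IsPeriodLattice φ Λ := by
  classical
  have hq : 1 < Fintype.card F := Fintype.one_lt_card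
  have hT := CInf.T_ne_zero (F := F)
  have hcl := isClosed_of_finiteDimensional M
  obtain ⟨e, he⟩ := exists_linearMap_eq_latticeExp hΛ
  obtain ⟨c, hcr, hc⟩ := exists_prod_X_sub_C_sum_smul_eq (F := F) r
    (fun i => latticeExp Λ ((b i : CInf F) / CInf.T F))
  obtain ⟨hc0, hfun⟩ := latticeExp_T_mul_eq_sum b hΛ hc
  simp only [← latticeExp_sum_div_T b hΛ] at hc
  have hl (a : Fin r → F) : ∑ i, a i • (b i : CInf F) ∈ Λ :=
    sum_mem fun i _ => constant_smul_mem (b i).2 _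
  have hsM (a : Fin r → F) : (∑ i, a i • (b i : CInf F)) / CInf.T F ∈ M :=
    div_mem (hM _ (hl a)) (T_mem M)
  let x : (Fin r → F) → M := fun a =>
    ⟨latticeExp Λ ((∑ i, a i • (b i : CInf F)) / CInf.T F),
      latticeExp_mem hΛ M.toSubfield hcl hM (hsM a)⟩
  have hxinj : Function.Injective x := by
    intro a a' haa
    have h1 := congrArg Subtype.val haa
    simp only [x] at h1
    rw [← sub_eq_zero, ← he, ← he, ← map_sub, he, latticeExp_eq_zero_iff hΛ, ← sub_div,
      ← Finset.sum_sub_distrib] at h1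
    simp only [← sub_smul] at h1
    exact sub_eq_zero.1 (eq_zero_of_sum_div_T_mem b (a := a - a') h1)
  -- `σ` fixes `T` and preserves `Λ`, so it permutes the classes of `T⁻¹Λ / Λ`, on which `e` is well
  -- defined.
  have hperm (σ : M ≃ₐ[L] M) (a : Fin r → F) : ∃ a', σ (x a) = x a' := by
    have hσ' (y : M) : (σ y : CInf F) ∈ Λ ↔ (y : CInf F) ∈ Λ :=
      ⟨fun h => by simpa using hσ σ.symm (σ y) h, hσ σ y⟩
    have h1 := latticeExp_algEquiv hΛ M hM σ hσ' ⟨_, hsM a⟩ (x a) rfl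
    have h2 : (⟨_, hsM a⟩ : M) =
        ⟨_, hM _ (hl a)⟩ / algebraMap L M (algebraMap (KInf F) L (KInf.T F)) := rfl
    rw [h2, map_div₀, AlgEquiv.commutes] at h1
    obtain ⟨m, hm, a', ha'⟩ := exists_eq_T_mul_add b (hσ σ ⟨_, hM _ (hl a)⟩ (hl a))
    refine ⟨a', Subtype.ext (h1.trans ?_)⟩
    have h3 : ((σ ⟨_, hM _ (hl a)⟩ / algebraMap L M (algebraMap (KInf F) L (KInf.T F)) : M) :
        CInf F) = m + (∑ i, a' i • (b i : CInf F)) / CInf.T F := by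
      change (σ ⟨_, hM _ (hl a)⟩ : CInf F) / CInf.T F = _
      rw [ha', add_div, mul_div_cancel_left₀ _ hT]
    rw [h3, ← he, map_add, he, he, latticeExp_of_mem hm, zero_add]
  let Q : M[X] := ∏ a : Fin r → F, (X - C (x a))
  have hQmap : Q.map (algebraMap M (CInf F)) =
      ∑ i ∈ Finset.range (r + 1), C (c i) * X ^ Fintype.card F ^ i := by
    rw [← hc, Polynomial.map_prod]
    refine Finset.prod_congr rfl fun a _ => ?_
    rw [Polynomial.map_sub, map_X, map_C]
    rfl
  have hQσ (σ : M ≃ₐ[L] M) : Q.map (σ : M →+* M) = Q := by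
    choose τ hτ using hperm σ
    have hτb : Function.Bijective τ := by
      refine Finite.injective_iff_bijective.1 fun a a' haa => hxinj (σ.injective ?_)
      rw [hτ, hτ, haa]
    rw [Polynomial.map_prod]
    refine Eq.trans (Finset.prod_congr rfl fun a _ => ?_) (hτb.prod_comp fun a => X - C (x a))
    rw [Polynomial.map_sub, map_X, map_C, ← hτ]
    rfl
  have hQL (n : ℕ) : ∃ y : L, algebraMap L M y = Q.coeff n := by
    rw [← Set.mem_range, IsGalois.mem_range_algebraMap_iff_fixed]
    intro σ
    conv_rhs => rw [← hQσ σ, coeff_map]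
    rfl
  have hcL (i : ℕ) (hi : i < r + 1) : ∃ y : L, algebraMap L (CInf F) y = c i := by
    obtain ⟨y, hy⟩ := hQL (Fintype.card F ^ i)
    refine ⟨y, ?_⟩
    have h1 := congrArg (fun p => coeff p (Fintype.card F ^ i)) hQmap
    simp only [coeff_map, finsetSum_coeff, coeff_C_mul_X_pow] at h1
    rw [Finset.sum_eq_single i, if_pos rfl] at h1
    · rw [← h1, ← hy]
      rfl
    · intro j _ hj
      exact if_neg fun h => hj (Nat.pow_right_injective hq h).symm
    · intro h
      exact absurd (Finset.mem_range.2 hi) h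
  choose g hg using fun i : Fin (r + 1) => hcL i i.2
  have hg0 : algebraMap L (CInf F) (g 0) = c 0 := hg 0
  have hTL : algebraMap L (CInf F) (algebraMap (KInf F) L (KInf.T F)) = CInf.T F := rfl
  have hg0' : g 0 ≠ 0 := fun h => hc0 (by rw [← hg0, h, map_zero])
  -- Scaling by `T / g 0` makes the linear coefficient `T`; the last coefficient is nonzero because
  -- `c r = 1`.
  let φ : DrinfeldModule L r :=
    { coeff := fun i => algebraMap (KInf F) L (KInf.T F) / g 0 * g i
      coeff_zero := div_mul_cancel₀ _ hg0'
      coeff_last := by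
        refine mul_ne_zero (div_ne_zero ?_ hg0') ?_
        · intro h
          exact hT (by rw [← hTL, h, map_zero])
        · intro h
          have := hg (Fin.last r)
          rw [h, map_zero, Fin.val_last, hcr] at this
          exact zero_ne_one this }
  have hcoeff (i : Fin (r + 1)) : (φ.coeff i : CInf F) = CInf.T F / c 0 * c i := by
    change algebraMap L (CInf F) (algebraMap (KInf F) L (KInf.T F) / g 0 * g i) = _
    rw [map_mul, map_div₀, hg0, hg, hTL]
  refine ⟨φ, ⟨?_, ?_, ?_, hΛ⟩, fun z => ?_⟩
  · exact Module.Free.of_basis b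
  · exact Module.Finite.of_basis b
  · rw [Module.finrank_eq_card_basis b, Fintype.card_fin]
  · rw [hfun, φ.opT_apply, ← Fin.sum_univ_eq_sum_range
      (fun i => CInf.T F / c 0 * c i * latticeExp Λ z ^ Fintype.card F ^ i)]
    simp only [hcoeff]

end Descent

/-! ### Value groups and ramification indices. -/

section Ramification

theorem mem_valueGroup {M : Subfield (CInf F)} {u : ℝˣ} :
    u ∈ valueGroup M ↔ ∃ x ∈ M, ‖x‖ = u := by
  constructor
  · rintro ⟨x, rfl⟩
    exact ⟨(x : M), (x : M).2, rfl⟩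
  · rintro ⟨x, hx, hxu⟩
    have h0 : (⟨x, hx⟩ : M) ≠ 0 := by
      intro h
      rw [Subtype.ext_iff] at h
      change x = 0 at h
      rw [h, norm_zero] at hxu
      exact u.ne_zero hxu.symm
    exact ⟨Units.mk0 _ h0, Units.ext hxu⟩

theorem norm_le_norm_sum_of_injOn {E ι : Type*} [NormedField E] [IsUltrametricDist E]
    (s : Finset ι) (f : ι → E)
    (h : ∀ i ∈ s, ∀ j ∈ s, f i ≠ 0 → f j ≠ 0 → ‖f i‖ = ‖f j‖ → i = j) {i : ι} (hi : i ∈ s) :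
    ‖f i‖ ≤ ‖∑ j ∈ s, f j‖ := by
  classical
  rcases eq_or_ne (f i) 0 with h0 | h0
  · simp [h0]
  have hp : Set.Pairwise (s.filter fun j => f j ≠ 0 : Finset ι)
      (fun i j => ‖f i‖₊ ≠ ‖f j‖₊) := by
    intro j hj k hk hjk hn
    simp only [Finset.coe_filter, Set.mem_ofPred_eq] at hj hk
    exact hjk (h j hj.1 k hk.1 hj.2 hk.2 (congrArg NNReal.toReal hn))
  rw [← Finset.sum_filter_ne_zero, ← coe_nnnorm, ← coe_nnnorm, NNReal.coe_le_coe,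
    IsUltrametricDist.nnnorm_sum_eq_sup_of_pairwise_ne hp]
  exact Finset.le_sup (f := fun i => ‖f i‖₊) (Finset.mem_filter.2 ⟨hi, h0⟩)

/-- The ramification index of a finite extension is finite and bounded by the degree. -/
theorem relIndex_valueGroup_le {k : Type*} [Field k] [Algebra k (CInf F)]
    (M : IntermediateField k (CInf F)) [FiniteDimensional k M] :
    (valueGroup (algebraMap k (CInf F)).fieldRange).relIndex (valueGroup M.toSubfield) ≠ 0 ∧
    (valueGroup (algebraMap k (CInf F)).fieldRange).relIndex (valueGroup M.toSubfield) ≤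
      Module.finrank k M := by
  set H := valueGroup (algebraMap k (CInf F)).fieldRange
  set G := valueGroup M.toSubfield
  have hx (t : G ⧸ H.subgroupOf G) : ∃ x : M, ‖(x : CInf F)‖ = ((t.out : G) : ℝˣ) := by
    obtain ⟨x, hx, hxt⟩ := mem_valueGroup.1 (t.out : G).2
    exact ⟨⟨x, hx⟩, hxt⟩
  choose x hx using hx
  -- Multiples of the `x t` by nonzero scalars of `k` have norms in different cosets, so they cannot
  -- cancel. Finiteness of the quotient follows, which rules out the default index 0.
  have hli : LinearIndependent k x := by
    rw [linearIndependent_iff']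
    intro s g hsum t ht
    have h1 : ∑ t ∈ s, algebraMap k (CInf F) (g t) * (x t : CInf F) = 0 := by
      have := congrArg M.val hsum
      rw [map_sum, map_zero] at this
      refine (Finset.sum_congr rfl fun t _ => ?_).trans this
      rw [map_smul, Algebra.smul_def]
      rfl
    have h2 := norm_le_norm_sum_of_injOn s
      (fun t => algebraMap k (CInf F) (g t) * (x t : CInf F)) (fun i _ j _ hi hj hij => ?_) ht
    · rw [h1, norm_zero, norm_le_zero_iff, mul_eq_zero, map_eq_zero] at h2
      refine h2.resolve_right fun h0 => ?_
      have := hx t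
      rw [h0, norm_zero] at this
      exact Units.ne_zero _ this.symm
    · rw [← Quotient.out_eq' i, ← Quotient.out_eq' j]
      refine QuotientGroup.eq.2 ?_
      rw [Subgroup.mem_subgroupOf, mem_valueGroup]
      have hgi : algebraMap k (CInf F) (g i) ≠ 0 := left_ne_zero_of_mul hi
      have hgj : algebraMap k (CInf F) (g j) ≠ 0 := left_ne_zero_of_mul hj
      refine ⟨algebraMap k (CInf F) (g i / g j), ⟨_, rfl⟩, ?_⟩
      rw [norm_mul, norm_mul, hx, hx] at hij
      rw [map_div₀, norm_div]
      simp only [Subgroup.coe_mul, InvMemClass.coe_inv, Units.val_mul]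
      have h3 : ((i.out : G) : ℝˣ) ≠ (0 : ℝ) := Units.ne_zero _
      rw [div_eq_iff (norm_ne_zero_iff.2 hgj), Units.val_inv_eq_inv_val]
      field_simp
      linarith
  have hfin : Finite (G ⧸ H.subgroupOf G) := hli.finite
  have := Fintype.ofFinite (G ⧸ H.subgroupOf G)
  have hcard : H.relIndex G = Fintype.card (G ⧸ H.subgroupOf G) := by
    rw [Subgroup.relIndex, Subgroup.index, Nat.card_eq_fintype_card]
  rw [hcard]
  exact ⟨Fintype.card_ne_zero, hli.fintype_card_le_finrank⟩

theorem KInf.exists_norm_eq_zpow {y : KInf F} (hy : y ≠ 0) :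
    ∃ j : ℤ, ‖y‖ = (Fintype.card F : ℝ) ^ j := by
  refine ⟨WithZero.log (Valued.v y), ?_⟩
  rw [← KInf.norm_T, ← norm_zpow, KInf.norm_def, KInf.norm_def, map_zpow₀, KInf.valuation_T,
    ← WithZero.exp_zsmul, smul_eq_mul, mul_one, WithZero.exp_log ((Valuation.ne_zero_iff _).2 hy)]

/-- Take for `D` the ramification index over `K_∞`: it kills the quotient of value groups, and norms
from `K_∞` are powers of `q`. -/
theorem exists_pow_norm_eq_zpow (L : IntermediateField (KInf F) (CInf F))
    [FiniteDimensional (KInf F) L] :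
    ∃ D : ℕ, D ≠ 0 ∧ ∀ x ∈ L, x ≠ 0 → ∃ j : ℤ, ‖x‖ ^ D = (Fintype.card F : ℝ) ^ j := by
  refine ⟨_, (relIndex_valueGroup_le L).1, fun x hx hx0 => ?_⟩
  set H := valueGroup (algebraMap (KInf F) (CInf F)).fieldRange
  set G := valueGroup L.toSubfield
  let u : G := ⟨Units.mk0 ‖x‖ (norm_ne_zero_iff.2 hx0), mem_valueGroup.2 ⟨x, hx, rfl⟩⟩
  have h1 : u ^ H.relIndex G ∈ H.subgroupOf G := Subgroup.pow_index_mem _ u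
  rw [Subgroup.mem_subgroupOf, mem_valueGroup] at h1
  obtain ⟨_, ⟨y, rfl⟩, hy⟩ := h1
  rw [norm_algebraMap'] at hy
  have hy' : ‖y‖ = ‖x‖ ^ H.relIndex G := hy
  have hy0 : y ≠ 0 := by
    rintro rfl
    rw [norm_zero] at hy'
    exact pow_ne_zero _ (norm_ne_zero_iff.2 hx0) hy'.symm
  rw [← hy']
  exact KInf.exists_norm_eq_zpow hy0

theorem fieldRange_algebraMap_eq (L : IntermediateField (KInf F) (CInf F)) :
    (algebraMap L (CInf F)).fieldRange = L.toSubfield := by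
  ext x
  exact ⟨fun ⟨y, hy⟩ => hy ▸ y.2, fun hx => ⟨⟨x, hx⟩, rfl⟩⟩

/-- The hypothesis says that `1, ‖ω‖, …, ‖ω‖^(N-1)` lie in distinct cosets of the value group of
`L`. -/
theorem le_ramificationIndex {L : IntermediateField (KInf F) (CInf F)}
    (M : IntermediateField L (CInf F)) [FiniteDimensional L M] {ω : CInf F} (hω : ω ∈ M)
    (hω0 : ω ≠ 0) {N : ℕ} (h : ∀ k, 0 < k → k < N → ∀ x ∈ L, ‖x‖ ≠ ‖ω‖ ^ k) :
    N ≤ ramificationIndex L.toSubfield M.toSubfield := by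
  have h1 := (relIndex_valueGroup_le M).1
  rw [fieldRange_algebraMap_eq] at h1
  rw [ramificationIndex]
  set H := valueGroup L.toSubfield
  set G := valueGroup M.toSubfield
  let u : G := ⟨Units.mk0 ‖ω‖ (norm_ne_zero_iff.2 hω0), mem_valueGroup.2 ⟨ω, hω, rfl⟩⟩
  have hfin : Finite (G ⧸ H.subgroupOf G) := Nat.finite_of_card_ne_zero h1
  have hlt (i j : ℕ) (hij : i < j) (hj : j < N) :
      ((u ^ i : G) : G ⧸ H.subgroupOf G) ≠ ((u ^ j : G) : G ⧸ H.subgroupOf G) := by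
    intro heq
    rw [QuotientGroup.eq, Subgroup.mem_subgroupOf] at heq
    have h2 : (u ^ i)⁻¹ * u ^ j = u ^ (j - i) := by
      rw [inv_mul_eq_iff_eq_mul, ← pow_add, Nat.add_sub_cancel' hij.le]
    rw [h2, mem_valueGroup] at heq
    obtain ⟨x, hx, hxu⟩ := heq
    exact h (j - i) (by omega) (by omega) x hx hxu
  have hinj : Function.Injective fun i : Fin N => ((u ^ (i : ℕ) : G) : G ⧸ H.subgroupOf G) := by
    intro i j hij
    rcases lt_trichotomy (i : ℕ) j with hlt' | heq | hgt
    · exact absurd hij (hlt i j hlt' j.2)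
    · exact Fin.ext heq
    · exact absurd hij.symm (hlt j i hgt i.2)
  have h3 := Nat.card_le_card_of_injective _ hinj
  rwa [Nat.card_eq_fintype_card, Fintype.card_fin] at h3

end Ramification

/-! ### An extension whose conjugates are translates by polynomials in `T`. -/

section Translates

theorem prod_sub_sum_smul_sub {E B : Type*} [Field E] [Algebra F E] [CommRing B] [Algebra F B]
    [Algebra E B] {k : ℕ} (v : Fin k → E) (x y : B) :
    ∏ a : Fin k → F, (x - y - algebraMap E B (∑ i, a i • v i)) =
      ∏ a : Fin k → F, (x - algebraMap E B (∑ i, a i • v i)) -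
        ∏ a : Fin k → F, (y - algebraMap E B (∑ i, a i • v i)) := by
  obtain ⟨c, -, hc⟩ := exists_prod_X_sub_C_sum_smul_eq (F := F) k v
  have key (z : B) : ∏ a : Fin k → F, (z - algebraMap E B (∑ i, a i • v i)) =
      ∑ i ∈ Finset.range (k + 1), algebraMap E B (c i) * z ^ Fintype.card F ^ i := by
    have := congrArg (aeval z) hc
    simpa only [map_prod, map_sub, aeval_X, aeval_C, map_sum (aeval z), map_mul, map_pow] using this
  simp only [key, sub_pow_card_pow, mul_sub, Finset.sum_sub_distrib]

variable (F) in
/-- The polynomial `∏ (X - b) - T ^ m`, with `b` in the space of polynomials in `T` of degree less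
than `n`. -/
def translatePoly (n m : ℕ) : (KInf F)[X] :=
  ∏ a : Fin n → F, (X - C (∑ j : Fin n, a j • KInf.T F ^ (j : ℕ))) - C (KInf.T F ^ m)

/-- The polynomial in `T` with coefficients `a`. -/
def polyOfCoeffs {n : ℕ} (a : Fin n → F) : F[X] := ((degreeLTEquiv F n).symm a : F[X])

theorem algebraMap_polyOfCoeffs {n : ℕ} (a : Fin n → F) :
    algebraMap F[X] (CInf F) (polyOfCoeffs a) =
      algebraMap (KInf F) (CInf F) (∑ j : Fin n, a j • KInf.T F ^ (j : ℕ)) := by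
  rw [IsScalarTower.algebraMap_apply F[X] (KInf F) (CInf F), KInf.algebraMap_apply]
  congr 1
  have : polyOfCoeffs a = ∑ j : Fin n, monomial (j : ℕ) (a j) := rfl
  rw [this, map_sum]
  refine Finset.sum_congr rfl fun j _ => ?_
  rw [aeval_monomial, Algebra.smul_def]

theorem polyOfCoeffs_injective {n : ℕ} :
    Function.Injective fun a : Fin n → F => algebraMap F[X] (CInf F) (polyOfCoeffs a) := by
  intro a a' h
  have h1 : polyOfCoeffs a - polyOfCoeffs a' = 0 := by
    by_contra h0
    refine algebraMap_poly_ne_zero h0 ?_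
    rw [map_sub, sub_eq_zero]
    exact h
  exact (degreeLTEquiv F n).symm.injective (Subtype.ext (sub_eq_zero.1 h1))

theorem norm_polyOfCoeffs_le {n : ℕ} (a : Fin n → F) :
    ‖algebraMap F[X] (CInf F) (polyOfCoeffs a)‖ ≤ (Fintype.card F : ℝ) ^ n := by
  have hq : (1 : ℝ) ≤ Fintype.card F := by exact_mod_cast Fintype.card_pos
  rcases eq_or_ne (polyOfCoeffs a) 0 with h0 | h0
  · rw [h0, map_zero, norm_zero]
    positivity
  · rw [norm_algebraMap_poly h0]
    refine pow_le_pow_right₀ hq ?_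
    have h1 : (polyOfCoeffs a).degree < n := mem_degreeLT.1 (Subtype.coe_prop _)
    rw [degree_eq_natDegree h0] at h1
    exact_mod_cast h1.le

theorem exists_root_translatePoly (n m : ℕ) :
    ∃ ω : CInf F, aeval ω (translatePoly F n m) = 0 := by
  have hdeg : (translatePoly F n m).natDegree = Fintype.card F ^ n := by
    rw [translatePoly, natDegree_sub_C, natDegree_prod_of_monic _ _ fun a _ => monic_X_sub_C _]
    simp only [natDegree_X_sub_C]
    simp
  obtain ⟨x, hx⟩ := IsAlgClosed.exists_aeval_eq_zero (KInfAlgCl F) (translatePoly F n m) (by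
    intro h
    rw [natDegree_eq_of_degree_eq_some h] at hdeg
    exact (pow_pos Fintype.card_pos n).ne hdeg)
  exact ⟨algebraMap (KInfAlgCl F) (CInf F) x, by rw [aeval_algebraMap_apply, hx, map_zero]⟩

variable {n m : ℕ} {ω : CInf F} (hω : aeval ω (translatePoly F n m) = 0)

include hω

theorem prod_root_sub_eq :
    ∏ a : Fin n → F, (ω - algebraMap F[X] (CInf F) (polyOfCoeffs a)) = CInf.T F ^ m := by
  rw [translatePoly, map_sub, sub_eq_zero, aeval_C, map_prod, map_pow] at hω
  refine Eq.trans (Finset.prod_congr rfl fun a _ => ?_) hω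
  rw [map_sub, aeval_X, aeval_C, algebraMap_polyOfCoeffs]

/-- If `P` is the additive product, then `P(X) - T^m = P(X) - P(ω) = P(X - ω)`. -/
theorem map_translatePoly :
    (translatePoly F n m).map (algebraMap (KInf F) (CInf F)) =
      ∏ a : Fin n → F, (X - C (ω + algebraMap F[X] (CInf F) (polyOfCoeffs a))) := by
  have h1 := prod_sub_sum_smul_sub (F := F) (B := (CInf F)[X])
    (fun j : Fin n => CInf.T F ^ (j : ℕ)) X (C ω)
  have h2 (a : Fin n → F) : ∑ j, a j • CInf.T F ^ (j : ℕ) =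
      algebraMap F[X] (CInf F) (polyOfCoeffs a) := by
    rw [algebraMap_polyOfCoeffs, map_sum]
    refine Finset.sum_congr rfl fun j _ => ?_
    rw [Algebra.smul_def, Algebra.smul_def, map_mul, map_pow,
      ← IsScalarTower.algebraMap_apply F (KInf F) (CInf F)]
    rfl
  simp only [h2, Polynomial.algebraMap_eq] at h1
  simp only [← C_sub (a := ω)] at h1
  rw [← map_prod C, prod_root_sub_eq hω] at h1
  rw [translatePoly, Polynomial.map_sub, Polynomial.map_prod, map_C, map_pow]
  simp only [C_add, ← sub_sub]
  rw [h1]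
  congr 1
  refine Finset.prod_congr rfl fun a _ => ?_
  rw [Polynomial.map_sub, map_X, map_C, algebraMap_polyOfCoeffs]

theorem exists_eq_add_of_root {x : CInf F} (hx : aeval x (translatePoly F n m) = 0) :
    ∃ a : Fin n → F, x = ω + algebraMap F[X] (CInf F) (polyOfCoeffs a) := by
  rw [← eval_map_algebraMap, map_translatePoly hω, eval_prod, Finset.prod_eq_zero_iff] at hx
  obtain ⟨a, -, ha⟩ := hx
  exact ⟨a, by simpa [sub_eq_zero] using ha⟩

/-- The field generated by a root of `∏ (X - b) - T ^ m` is Galois. -/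
theorem isGalois_adjoin_root (L : IntermediateField (KInf F) (CInf F)) :
    FiniteDimensional L (IntermediateField.adjoin L {ω}) ∧
      IsGalois L (IntermediateField.adjoin L {ω}) := by
  set M := IntermediateField.adjoin L {ω} with hM
  have hωM : ω ∈ M := IntermediateField.mem_adjoin_simple_self L ω
  let p : L[X] := (translatePoly F n m).map (algebraMap (KInf F) L)
  have hp : p.map (algebraMap L (CInf F)) =
      ∏ a : Fin n → F, (X - C (ω + algebraMap F[X] (CInf F) (polyOfCoeffs a))) := by
    rw [← map_translatePoly hω, Polynomial.map_map]
    rfl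
  have hp0 : p.map (algebraMap L (CInf F)) ≠ 0 := by
    rw [hp, Finset.prod_ne_zero_iff]
    exact fun a _ => X_sub_C_ne_zero _
  have hroot (x : CInf F) : x ∈ p.rootSet (CInf F) ↔
      ∃ a : Fin n → F, x = ω + algebraMap F[X] (CInf F) (polyOfCoeffs a) := by
    rw [mem_rootSet', and_iff_right hp0, ← eval_map_algebraMap, hp, eval_prod,
      Finset.prod_eq_zero_iff]
    simp [sub_eq_zero]
  have hωroot : ω ∈ p.rootSet (CInf F) := (hroot ω).2 ⟨0, by simp [polyOfCoeffs]⟩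
  have hsep : p.Separable := by
    rw [← separable_map (algebraMap L (CInf F)), hp, separable_prod_X_sub_C_iff]
    intro a a' h
    exact polyOfCoeffs_injective (add_left_cancel h)
  have hsplit : (p.map (algebraMap L (CInf F))).Splits := by
    rw [hp]
    exact Splits.prod fun a _ => Splits.X_sub_C _
  have hsub : ∀ x ∈ p.rootSet (CInf F), x ∈ M := by
    intro x hx
    obtain ⟨a, rfl⟩ := (hroot x).1 hx
    exact add_mem hωM (algebraMap_poly_mem _ _)
  have hsf : p.IsSplittingField L M := by
    refine IntermediateField.isSplittingField_iff.2
      ⟨IntermediateField.splits_of_splits hsplit hsub, le_antisymm ?_ ?_⟩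
    · rw [hM, IntermediateField.adjoin_simple_le_iff]
      exact IntermediateField.subset_adjoin L _ hωroot
    · exact IntermediateField.adjoin_le_iff.2 hsub
  exact ⟨Polynomial.IsSplittingField.finiteDimensional M p,
    IsGalois.of_separable_splitting_field hsep⟩

/-- If `‖ω‖ ≤ q^n`, the `q^n` factors `ω - b` would have product of norm at most `q^(n q^n) < q^m`.
So `ω` dominates every `b`, and each factor has norm `‖ω‖`. -/
theorem norm_root_pow (hm : m = n * Fintype.card F ^ n + 1) :
    (Fintype.card F : ℝ) ^ n < ‖ω‖ ∧
      ‖ω‖ ^ Fintype.card F ^ n = (Fintype.card F : ℝ) ^ m := by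
  have hq : (1 : ℝ) < Fintype.card F := by exact_mod_cast Fintype.one_lt_card
  have h1 := congrArg norm (prod_root_sub_eq hω)
  rw [norm_prod, norm_pow, CInf.norm_T] at h1
  have hcard : (Finset.univ : Finset (Fin n → F)).card = Fintype.card F ^ n := by simp
  have hlt : (Fintype.card F : ℝ) ^ n < ‖ω‖ := by
    by_contra! hle
    have h2 : ∏ a : Fin n → F, ‖ω - algebraMap F[X] (CInf F) (polyOfCoeffs a)‖ ≤
        ∏ _a : Fin n → F, (Fintype.card F : ℝ) ^ n := by
      refine Finset.prod_le_prod (fun _ _ => norm_nonneg _) fun a _ => ?_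
      rw [sub_eq_add_neg]
      refine (IsUltrametricDist.norm_add_le_max _ _).trans (max_le hle ?_)
      rw [norm_neg]
      exact norm_polyOfCoeffs_le a
    rw [Finset.prod_const, hcard, h1, ← pow_mul, pow_le_pow_iff_right₀ hq] at h2
    omega
  refine ⟨hlt, ?_⟩
  rw [← h1, ← hcard, ← Finset.prod_const]
  refine Finset.prod_congr rfl fun a _ => ?_
  have h3 : ‖-algebraMap F[X] (CInf F) (polyOfCoeffs a)‖ < ‖ω‖ := by
    rw [norm_neg]
    exact (norm_polyOfCoeffs_le a).trans_lt hlt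
  rw [sub_eq_add_neg, IsUltrametricDist.norm_add_eq_max_of_norm_ne_norm h3.ne', max_eq_left h3.le]

end Translates

/-! ### The lattice spanned by powers of `ω`. -/

section PowerLattice

/-- The `F[T]`-module generated by `1, ω, …, ω ^ (r - 1)`. -/
def powerLattice (ω : CInf F) (r : ℕ) : Submodule F[X] (CInf F) :=
  Submodule.span F[X] (Set.range fun i : Fin r => ω ^ (i : ℕ))

theorem mem_powerLattice {ω : CInf F} {r : ℕ} {x : CInf F} :
    x ∈ powerLattice ω r ↔
      ∃ p : Fin r → F[X], ∑ i, algebraMap F[X] (CInf F) (p i) * ω ^ (i : ℕ) = x := by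
  simp only [← Algebra.smul_def]
  exact Submodule.mem_span_range_iff_exists_fun _

theorem pow_mem_powerLattice (ω : CInf F) {r i : ℕ} (hi : i < r) : ω ^ i ∈ powerLattice ω r :=
  Submodule.subset_span ⟨⟨i, hi⟩, rfl⟩

theorem add_pow_mem_powerLattice (ω : CInf F) {r i : ℕ} (hi : i < r) (b : F[X]) :
    (ω + algebraMap F[X] (CInf F) b) ^ i ∈ powerLattice ω r := by
  rw [add_pow]
  refine sum_mem fun j hj => ?_
  have h1 : ω ^ j * algebraMap F[X] (CInf F) b ^ (i - j) * (i.choose j : CInf F) =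
      (b ^ (i - j) * (i.choose j : F[X])) • ω ^ j := by
    rw [Algebra.smul_def, map_mul, map_pow, map_natCast]
    ring
  rw [h1]
  refine Submodule.smul_mem _ _ (pow_mem_powerLattice ω ?_)
  have := Finset.mem_range.1 hj
  omega

variable {n m r : ℕ} {ω : CInf F}

/-- The `q^n`-th power of the norm of a nonzero term is `q` to an exponent congruent to `m i` modulo
`q^n`. Since `m` is prime to `q^n` and `i < q^n`, the norms are distinct and nothing cancels.
Independence and discreteness both follow. -/
theorem norm_mul_pow_le_norm_sum (hr : r ≤ Fintype.card F ^ n)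
    (hm : Nat.Coprime (Fintype.card F ^ n) m)
    (hω : ‖ω‖ ^ Fintype.card F ^ n = (Fintype.card F : ℝ) ^ m) (p : Fin r → F[X]) (i : Fin r) :
    ‖algebraMap F[X] (CInf F) (p i) * ω ^ (i : ℕ)‖ ≤
      ‖∑ i, algebraMap F[X] (CInf F) (p i) * ω ^ (i : ℕ)‖ := by
  have hq : (1 : ℝ) < Fintype.card F := by exact_mod_cast Fintype.one_lt_card
  refine norm_le_norm_sum_of_injOn Finset.univ
    (fun i : Fin r => algebraMap F[X] (CInf F) (p i) * ω ^ (i : ℕ)) (fun i _ j _ hi hj hij => ?_)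
    (Finset.mem_univ i)
  have hnorm (k : Fin r) (hk : algebraMap F[X] (CInf F) (p k) * ω ^ (k : ℕ) ≠ 0) :
      ‖algebraMap F[X] (CInf F) (p k) * ω ^ (k : ℕ)‖ ^ Fintype.card F ^ n =
        (Fintype.card F : ℝ) ^ ((p k).natDegree * Fintype.card F ^ n + m * k) := by
    have hk0 : p k ≠ 0 := by
      intro h
      rw [h, map_zero, zero_mul] at hk
      exact hk rfl
    rw [norm_mul, norm_pow, norm_algebraMap_poly hk0, mul_pow, pow_right_comm ‖ω‖, hω,
      ← pow_mul, ← pow_mul, ← pow_add]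
  have h1 := congrArg (· ^ Fintype.card F ^ n) hij
  simp only [hnorm i hi, hnorm j hj] at h1
  have h2 := pow_right_injective₀ (by positivity) hq.ne' h1
  have h3 : m * i ≡ m * j [MOD Fintype.card F ^ n] := by
    have h4 := congrArg (· % Fintype.card F ^ n) h2
    simpa [Nat.ModEq, Nat.add_mod] using h4
  have h4 := Nat.ModEq.cancel_left_of_coprime hm h3
  exact Fin.ext (h4.eq_of_lt_of_lt (i.2.trans_le hr) (j.2.trans_le hr))

theorem linearIndependent_pow (hr : r ≤ Fintype.card F ^ n)
    (hm : Nat.Coprime (Fintype.card F ^ n) m)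
    (hω : ‖ω‖ ^ Fintype.card F ^ n = (Fintype.card F : ℝ) ^ m) (hω0 : ω ≠ 0) :
    LinearIndependent F[X] fun i : Fin r => ω ^ (i : ℕ) := by
  rw [Fintype.linearIndependent_iff]
  intro p hp i
  simp only [Algebra.smul_def] at hp
  have h1 := norm_mul_pow_le_norm_sum hr hm hω p i
  rw [hp, norm_zero, norm_le_zero_iff] at h1
  by_contra h0
  exact mul_ne_zero (algebraMap_poly_ne_zero h0) (pow_ne_zero _ hω0) h1

theorem discrete_powerLattice (hr : r ≤ Fintype.card F ^ n)
    (hm : Nat.Coprime (Fintype.card F ^ n) m)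
    (hω : ‖ω‖ ^ Fintype.card F ^ n = (Fintype.card F : ℝ) ^ m) (hω1 : 1 ≤ ‖ω‖) (R : ℝ) :
    {l : CInf F | l ∈ powerLattice ω r ∧ ‖l‖ ≤ R}.Finite := by
  have hq : (1 : ℝ) < Fintype.card F := by exact_mod_cast Fintype.one_lt_card
  obtain ⟨k, hk⟩ := pow_unbounded_of_one_lt R hq
  refine (Set.finite_range fun a : Fin r → Fin k → F =>
    ∑ i, algebraMap F[X] (CInf F) (polyOfCoeffs (a i)) * ω ^ (i : ℕ)).subset ?_
  rintro l ⟨hl, hlR⟩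
  obtain ⟨p, rfl⟩ := mem_powerLattice.1 hl
  have hdeg (i : Fin r) : p i ∈ degreeLT F k := by
    rcases eq_or_ne (p i) 0 with h0 | h0
    · rw [h0]
      exact Submodule.zero_mem _
    have h1 := (norm_mul_pow_le_norm_sum hr hm hω p i).trans hlR
    rw [norm_mul, norm_pow, norm_algebraMap_poly h0] at h1
    have h2 : (Fintype.card F : ℝ) ^ (p i).natDegree < (Fintype.card F : ℝ) ^ k :=
      ((le_mul_of_one_le_right (by positivity) (one_le_pow₀ hω1)).trans h1).trans_lt hk
    rw [mem_degreeLT, degree_eq_natDegree h0]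
    exact_mod_cast (pow_lt_pow_iff_right₀ hq).1 h2
  exact ⟨fun i => degreeLTEquiv F k ⟨p i, hdeg i⟩, by simp [polyOfCoeffs]⟩

/-- The powers of a root of `∏ (X - b) - T ^ m` span a Galois stable module. -/
theorem algEquiv_mem_powerLattice {L : IntermediateField (KInf F) (CInf F)}
    (hω : aeval ω (translatePoly F n m) = 0) (M : IntermediateField L (CInf F)) (hωM : ω ∈ M)
    (σ : M ≃ₐ[L] M) (x : M) (hx : (x : CInf F) ∈ powerLattice ω r) :
    (σ x : CInf F) ∈ powerLattice ω r := by
  obtain ⟨p, hp⟩ := mem_powerLattice.1 hx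
  let A (a : F[X]) : M := algebraMap L M (algebraMap (KInf F) L (algebraMap F[X] (KInf F) a))
  have hA (a : F[X]) : (A a : CInf F) = algebraMap F[X] (CInf F) a := by
    rw [IsScalarTower.algebraMap_apply F[X] (KInf F) (CInf F)]
    rfl
  have hroot : aeval (σ ⟨ω, hωM⟩ : CInf F) (translatePoly F n m) = 0 := by
    let f : M →ₐ[L] CInf F := M.val.comp σ.toAlgHom
    have h1 (g : M →ₐ[L] CInf F) :
        aeval (g ⟨ω, hωM⟩) ((translatePoly F n m).map (algebraMap (KInf F) L)) =
          g (aeval (⟨ω, hωM⟩ : M) ((translatePoly F n m).map (algebraMap (KInf F) L))) :=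
      aeval_algHom_apply g _ _
    have h2 (y : CInf F) : aeval y ((translatePoly F n m).map (algebraMap (KInf F) L)) =
        aeval y (translatePoly F n m) := aeval_map_algebraMap L y _
    have h3 : aeval (⟨ω, hωM⟩ : M) ((translatePoly F n m).map (algebraMap (KInf F) L)) = 0 := by
      apply Subtype.ext
      refine (h1 M.val).symm.trans ?_
      rw [h2]
      exact hω
    have h4 := h1 f
    rw [h2, h3, map_zero] at h4
    exact h4
  -- Thus `σ ω = ω + b`, and the binomial expansion of `(ω + b)^i` stays in the span.
  obtain ⟨a, ha⟩ := exists_eq_add_of_root hω hroot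
  have hx' : x = ∑ i, A (p i) * (⟨ω, hωM⟩ : M) ^ (i : ℕ) := by
    apply Subtype.ext
    rw [← hp, ← M.coe_val, map_sum]
    refine Finset.sum_congr rfl fun i _ => ?_
    rw [map_mul, map_pow, ← hA]
    rfl
  have hσx : (σ x : CInf F) =
      ∑ i, p i • (ω + algebraMap F[X] (CInf F) (polyOfCoeffs a)) ^ (i : ℕ) := by
    rw [hx', map_sum, ← M.coe_val, map_sum]
    refine Finset.sum_congr rfl fun i _ => ?_
    rw [map_mul, map_pow, map_mul, map_pow, Algebra.smul_def, ← hA, ← ha, AlgEquiv.commutes]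
    rfl
  rw [hσx]
  exact sum_mem fun i _ => Submodule.smul_mem _ _ (add_pow_mem_powerLattice ω i.2 _)

end PowerLattice

/-- There are Drinfeld modules whose period lattice generates an arbitrarily ramified extension. -/
theorem exists_isPeriodLattice_le_ramificationIndex (L : IntermediateField (KInf F) (CInf F))
    [FiniteDimensional (KInf F) L] {r : ℕ} (hr : 2 ≤ r) (N : ℕ) :
    ∃ (φ : DrinfeldModule L r) (Λ : Submodule F[X] (CInf F)), IsPeriodLattice φ Λ ∧
      N ≤ ramificationIndex L.toSubfield
        (IntermediateField.adjoin L (Λ : Set (CInf F))).toSubfield := by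
  have hq : 1 < Fintype.card F := Fintype.one_lt_card
  have hq' : (1 : ℝ) < Fintype.card F := by exact_mod_cast hq
  obtain ⟨D, hD0, hD⟩ := exists_pow_norm_eq_zpow L
  -- This gives `q^n > n ≥ r`, as needed for independence, and `q^n > k D` for every `k < N`, as
  -- needed for ramification.
  set n := N * D + r with hn
  have hnlt : n < Fintype.card F ^ n := Nat.lt_pow_self hq
  set m := n * Fintype.card F ^ n + 1 with hm
  have hcop : Nat.Coprime (Fintype.card F ^ n) m := by
    rw [hm, mul_comm]
    simp
  have hrn : r ≤ Fintype.card F ^ n := by omega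
  obtain ⟨ω, hω⟩ := exists_root_translatePoly (F := F) n m
  obtain ⟨hωlt, hωpow⟩ := norm_root_pow hω hm
  have hω1 : 1 ≤ ‖ω‖ := (one_le_pow₀ hq'.le).trans hωlt.le
  have hω0 : ω ≠ 0 := norm_pos_iff.1 (one_pos.trans_le hω1)
  obtain ⟨hfd, hgal⟩ := isGalois_adjoin_root hω L
  have hωM := IntermediateField.mem_adjoin_simple_self L ω
  set M := IntermediateField.adjoin L {ω} with hM
  have hΛM : ∀ l ∈ powerLattice ω r, l ∈ M := by
    intro l hl
    obtain ⟨p, rfl⟩ := mem_powerLattice.1 hl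
    exact sum_mem fun i _ => mul_mem (algebraMap_poly_mem _ _) (pow_mem hωM _)
  have hadj : IntermediateField.adjoin L (powerLattice ω r : Set (CInf F)) = M := by
    refine le_antisymm (IntermediateField.adjoin_le_iff.2 hΛM) ?_
    rw [hM, IntermediateField.adjoin_simple_le_iff]
    refine IntermediateField.subset_adjoin L _ ?_
    -- Rank at least 2 is needed for `ω` itself to lie in the lattice.
    have := pow_mem_powerLattice ω (r := r) (i := 1) (by omega)
    rwa [pow_one] at this
  obtain ⟨φ, hφ⟩ := exists_drinfeldModule_of_galois
    (Module.Basis.span (linearIndependent_pow hrn hcop hωpow hω0))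
    (discrete_powerLattice hrn hcop hωpow hω1) M hΛM
    (fun σ x hx => algEquiv_mem_powerLattice hω M hωM σ x hx)
  refine ⟨φ, powerLattice ω r, hφ, ?_⟩
  rw [hadj]
  refine le_ramificationIndex M hωM hω0 fun k hk0 hkN x hx hxk => ?_
  have hx0 : x ≠ 0 := by
    rintro rfl
    rw [norm_zero] at hxk
    exact pow_ne_zero k (norm_ne_zero_iff.2 hω0) hxk.symm
  obtain ⟨j, hj⟩ := hD x hx hx0
  -- raise `‖ω‖ ^ (k D) = q ^ j` to the power `q ^ n`
  have h1 : (Fintype.card F : ℝ) ^ ((m * (k * D) : ℕ) : ℤ) =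
      (Fintype.card F : ℝ) ^ (j * (Fintype.card F ^ n : ℕ)) := by
    rw [zpow_natCast, pow_mul, ← hωpow, ← pow_mul, mul_comm, pow_mul, pow_mul, ← hxk, hj,
      zpow_mul, zpow_natCast]
  have h2 := zpow_right_injective₀ (by positivity) hq'.ne' h1
  have h3 : Fintype.card F ^ n ∣ m * (k * D) := by
    rw [← Int.natCast_dvd_natCast, h2]
    exact dvd_mul_left _ _
  -- Coprimality with `m` leaves `q^n ∣ k D`, so `q^n ≤ k D ≤ N D ≤ n`, contradicting `n < q^n`.
  have h4 := Nat.le_of_dvd (Nat.mul_pos hk0 (Nat.pos_of_ne_zero hD0))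
    (hcop.dvd_of_dvd_mul_left h3)
  have h5 : k * D ≤ N * D := Nat.mul_le_mul_right D hkN.le
  omega

end DrinfeldPeriods

end

theorem theorem3 {F : Type*} [Field F] [Fintype F]
    (L : IntermediateField (KInf F) (CInf F)) [FiniteDimensional (KInf F) L]
    (r : ℕ) (hr : 2 ≤ r) :
    (∀ (φ : DrinfeldModule L r) (Λ : Submodule (Polynomial F) (CInf F)), IsPeriodLattice φ Λ →
      FiniteDimensional L (IntermediateField.adjoin L (Λ : Set (CInf F))) ∧
      IntermediateField.adjoin L (Λ : Set (CInf F)) = IntermediateField.adjoin L φ.tor) ∧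
    ∀ N : ℕ, ∃ (φ : DrinfeldModule L r) (Λ : Submodule (Polynomial F) (CInf F)),
      IsPeriodLattice φ Λ ∧
      N ≤ ramificationIndex L.toSubfield
        (IntermediateField.adjoin L (Λ : Set (CInf F))).toSubfield ∧
      N ≤ Module.finrank L (IntermediateField.adjoin L (Λ : Set (CInf F))) := by
  have hr0 : r ≠ 0 := by omega
  refine ⟨fun φ Λ h => ⟨h.finiteDimensional_adjoin hr0, h.adjoin_eq_adjoin_tor hr0⟩, fun N => ?_⟩
  obtain ⟨φ, Λ, h, hN⟩ := exists_isPeriodLattice_le_ramificationIndex L hr N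
  have := h.finiteDimensional_adjoin hr0
  have hle := (relIndex_valueGroup_le (IntermediateField.adjoin L (Λ : Set (CInf F)))).2
  rw [fieldRange_algebraMap_eq] at hle
  exact ⟨φ, Λ, h, hN, hN.trans hle⟩
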